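/- Consider the problem $\min_{x\in\mathbb R^n} f(x)+h(x)$ subject to $g_i(x)\le 0$ for $i=1,\dots,m$, under the following assumptions. (A) $f:\mathbb R^n\to\mathbb R$ is convex and differentiable with Lipschitz continuous gradient; $h:\mathbb R^n\to(-\infty,+\infty]$ is proper, lower semicontinuous and convex, with bounded domain $\operatorname{dom}h$, and $\min_v\langle u,v\rangle+h(v)$ has a minimizer for every $u\in\mathbb R^n$; each $g_i:\mathbb R^n\to\mathbb R$ is convex and differentiable, with $\nabla g_i$ Lipschitz continuous on $\operatorname{dom}h$; and the problem has a KKT point, that is, a pair $(x^*,z^*)\in\mathbb R^n\times\mathbb R^m$ with $0\in\nabla f(x^*)+\partial h(x^*)+\sum_i z_i^*\nabla g_i(x^*)$, $g_i(x^*)\le0$ and $z_i^*\ge0$ for all $i$, and $\sum_i z_i^*g_i(x^*)=0$. (B) $h$ is the indicator function ($0$ on $\mathcal C$, $+\infty$ elsewhere) of a compact convex set $\mathcal C$ that is $(\nu,q)$-uniformly convex for some $\nu>0$, $q\ge2$: for all $x,y\in\mathcal C$, $t\in[0,1]$ and all $w$ with $\|w\|=1$, $tx+(1-t)y+t(1-t)\nu\|x-y\|^q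 w\in\mathcal C$. Moreover, for some $\epsilon>0$, the infimum of $\|\nabla f(x)+\sum_i z_i\nabla g_i(x)\|$ over all $x\in\mathcal C$, $z\in\mathbb R^m_+$ such that $g_i(x)\le\epsilon$ for all $i$ and $z_i=0$ whenever $g_i(x)<-\epsilon$, is positive. For $\lambda>0$ put $$F_\lambda(x,z)=f(x)+\frac\lambda2\sum_{i=1}^m\Big(\big[g_i(x)+\tfrac{z_i}{\lambda}\big]_+^2-\big(\tfrac{z_i}{\lambda}\big)^2\Big),\qquad \mathcal L_\lambda(x,z)=F_\lambda(x,z)+h(x),$$ and let $L^*$ be the optimal value of the problem. Let $(x^k,z^k)$ be generated by the following algorithm: $x^0\in\operatorname{dom}h$, $z^0\in\mathbb R^m_+$ and, for $k\ge0$, $$v^k\in\operatorname{Arg\,min}_v\ \langle\nabla_xF_{\lambda_k}(x^k,z^k),v\rangle+h(v),\qquad x^{k+1}=x^k+\alpha_k(v^k-x^k),$$ $$z^{k+1}=z^k+\sigma_k\max\{-z^k/\lambda_k,\,g(x^{k+1})\}\quad\text{(componentwise)},$$ where (C) $0<\lambda_k<\lambda_{k+1}$, $\lambda_k=\Theta(k^{\tau})$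 and $\lambda_{k+1}-\lambda_k=\mathcal O(k^{-(1-\tau)})$ for some $\tau\in(0,1)$; $\alpha_k\in(0,1]$ is nonincreasing and $\alpha_k=\Theta(k^{-p})$ for some $p\in(\tau,1)$; and $0<\sigma_k\le\lambda_k$, $\sigma_k=\Theta(k^{-(1+\gamma)})$ for some $\gamma>0$. Let $T_k=[\mathcal L_{\lambda_k}(x^k,z^k)-L^*]_+$, $\mu=1-2/q$ and $\omega=\min\{p-\tau,\,1-p+\tau\}$. Then $$T_k=\begin{cases}\mathcal O\big(k^{-(1-p+\tau)}\big)&\text{if }\mu=0,\\[2pt] \mathcal O\big(\max\{k^{-((1-\mu)\omega+p-\tau)},\,k^{-(1-p+\tau)}\}\big)&\text{if }\mu\in(0,1).\end{cases}$$ Moreover, if $\mu=0$ (that is, $\mathcal C$ is strongly convex), the rates can be made arbitrarily close to $\mathcal O(1/k)$: for every $\rho<1$ there is $\tau_0<1$ such that, whenever $\tau>\tau_0$, each of $T_k$, $|f(x^k)+h(x^k)-L^*|$ and $\|[g(x^k)]_+\|$ is $\mathcal O(k^{-\rho})$. -/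

import Mathlib

namespace CGAL

open Filter Asymptotics

noncomputable section

/-! ### The problem `min f(x) + h(x)` subject to `g i x ≤ 0`, with `h` extended-real-valued -/

/-- The effective domain of an extended-real-valued function. -/
def dom {n : ℕ} (h : EuclideanSpace ℝ (Fin n) → EReal) : Set (EuclideanSpace ℝ (Fin n)) :=
  {x | h x < ⊤}

/-- The indicator function of a set in the sense of convex analysis: `0` on `C`, `∞` off `C`. -/
def ind {n : ℕ} (C : Set (EuclideanSpace ℝ (Fin n))) (x : EuclideanSpace ℝ (Fin n)) : EReal :=
  open Classical in if x ∈ C then 0 else ⊤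

/-- The (convex) subdifferential of `h` at `x`. -/
def subdifferential {n : ℕ} (h : EuclideanSpace ℝ (Fin n) → EReal)
    (x : EuclideanSpace ℝ (Fin n)) : Set (EuclideanSpace ℝ (Fin n)) :=
  {ξ | ∀ y, h x + ((inner ℝ ξ (y - x) : ℝ) : EReal) ≤ h y}

/-- `v` is a solution of the linear minimization problem `min_v ⟨u, v⟩ + h v`. -/
def IsLMO {n : ℕ} (h : EuclideanSpace ℝ (Fin n) → EReal) (u v : EuclideanSpace ℝ (Fin n)) : Prop :=
  ∀ w, ((inner ℝ u v : ℝ) : EReal) + h v ≤ ((inner ℝ u w : ℝ) : EReal) + h w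

/-- `(x, z)` is a KKT point of the problem. -/
structure IsKKT {n m : ℕ} (f : EuclideanSpace ℝ (Fin n) → ℝ)
    (h : EuclideanSpace ℝ (Fin n) → EReal) (g : Fin m → EuclideanSpace ℝ (Fin n) → ℝ)
    (x : EuclideanSpace ℝ (Fin n)) (z : EuclideanSpace ℝ (Fin m)) : Prop where
  stationary : ∃ ξ ∈ subdifferential h x, gradient f x + ξ + ∑ i, z i • gradient (g i) x = 0
  feasible : ∀ i, g i x ≤ 0
  dual_nonneg : ∀ i, 0 ≤ z i
  complementary : ∑ i, z i * g i x = 0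

/-- Standing assumptions on `f`, `h` and `g`. -/
structure StandingAssumption {n m : ℕ} (f : EuclideanSpace ℝ (Fin n) → ℝ)
    (h : EuclideanSpace ℝ (Fin n) → EReal)
    (g : Fin m → EuclideanSpace ℝ (Fin n) → ℝ) : Prop where
  f_convex : ConvexOn ℝ Set.univ f
  f_differentiable : Differentiable ℝ f
  f_lipschitz : ∃ L : ℝ, 0 < L ∧ ∀ x y, ‖gradient f x - gradient f y‖ ≤ L * ‖x - y‖
  h_ne_bot : ∀ x, h x ≠ ⊥
  h_proper : (dom h).Nonempty
  h_closed : LowerSemicontinuous h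
  h_convex : Convex ℝ {P : EuclideanSpace ℝ (Fin n) × ℝ | h P.1 ≤ (P.2 : EReal)}
  h_bounded : ∃ D : ℝ, 0 < D ∧ ∀ x ∈ dom h, ∀ y ∈ dom h, ‖x - y‖ ≤ D
  h_lmo : ∀ u, ∃ v, IsLMO h u v
  g_convex : ∀ i, ConvexOn ℝ Set.univ (g i)
  g_differentiable : ∀ i, Differentiable ℝ (g i)
  g_lipschitz : ∀ i, ∃ L : ℝ, 0 < L ∧
    ∀ x ∈ dom h, ∀ y ∈ dom h, ‖gradient (g i) x - gradient (g i) y‖ ≤ L * ‖x - y‖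
  exists_kkt : ∃ x z, IsKKT f h g x z

/-- The optimal value `L*` of the problem. -/
def optValue {n m : ℕ} (f : EuclideanSpace ℝ (Fin n) → ℝ)
    (h : EuclideanSpace ℝ (Fin n) → EReal) (g : Fin m → EuclideanSpace ℝ (Fin n) → ℝ) : EReal :=
  ⨅ x ∈ {x | ∀ i, g i x ≤ 0}, (f x : EReal) + h x

/-! ### The augmented Lagrangian -/

/-- `ψ_t(u, v) = (t / 2) ([u + v / t]₊² - (v / t)²)`. -/
def psi (t u v : ℝ) : ℝ := t / 2 * ((max (u + v / t) 0) ^ 2 - (v / t) ^ 2)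

/-- The smooth part `F_λ(x, z) = f x + ∑ i, ψ_λ(g i x, z i)` of the augmented Lagrangian. -/
def smoothPart {n m : ℕ} (f : EuclideanSpace ℝ (Fin n) → ℝ)
    (g : Fin m → EuclideanSpace ℝ (Fin n) → ℝ) (lam : ℝ)
    (x : EuclideanSpace ℝ (Fin n)) (z : EuclideanSpace ℝ (Fin m)) : ℝ :=
  f x + ∑ i, psi lam (g i x) (z i)

/-- The augmented Lagrangian `𝓛_λ(x, z) = F_λ(x, z) + h x`. -/
def augLagrangian {n m : ℕ} (f : EuclideanSpace ℝ (Fin n) → ℝ)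
    (h : EuclideanSpace ℝ (Fin n) → EReal) (g : Fin m → EuclideanSpace ℝ (Fin n) → ℝ)
    (lam : ℝ) (x : EuclideanSpace ℝ (Fin n)) (z : EuclideanSpace ℝ (Fin m)) : EReal :=
  (smoothPart f g lam x z : EReal) + h x

/-- `T_λ(x, z) = [𝓛_λ(x, z) - L*]₊`. -/
def gapT {n m : ℕ} (f : EuclideanSpace ℝ (Fin n) → ℝ)
    (h : EuclideanSpace ℝ (Fin n) → EReal) (g : Fin m → EuclideanSpace ℝ (Fin n) → ℝ)
    (lam : ℝ) (x : EuclideanSpace ℝ (Fin n)) (z : EuclideanSpace ℝ (Fin m)) : EReal :=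
  max (augLagrangian f h g lam x z - optValue f h g) 0

/-! ### The algorithm -/

/-- The sequences `x, z, v` are generated by the single-loop conditional-gradient augmented
Lagrangian method with primal stepsizes `α`, penalty parameters `lam`, dual stepsizes `σ`. -/
structure IsRun {n m : ℕ} (f : EuclideanSpace ℝ (Fin n) → ℝ)
    (h : EuclideanSpace ℝ (Fin n) → EReal) (g : Fin m → EuclideanSpace ℝ (Fin n) → ℝ)
    (α lam σ : ℕ → ℝ) (x : ℕ → EuclideanSpace ℝ (Fin n)) (z : ℕ → EuclideanSpace ℝ (Fin m))
    (v : ℕ → EuclideanSpace ℝ (Fin n)) : Prop where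
  x_zero : x 0 ∈ dom h
  z_zero : ∀ i, 0 ≤ z 0 i
  α_mem : ∀ k, α k ∈ Set.Icc (0 : ℝ) 1
  lam_pos : ∀ k, 0 < lam k
  lam_strictMono : StrictMono lam
  lam_tendsto : Tendsto lam atTop atTop
  σ_pos : ∀ k, 0 < σ k
  σ_summable : Summable σ
  σ_le : ∀ k, σ k ≤ lam k
  v_step : ∀ k, IsLMO h (gradient (fun y => smoothPart f g (lam k) y (z k)) (x k)) (v k)
  x_step : ∀ k, x (k + 1) = x k + α k • (v k - x k)
  z_step : ∀ k i, z (k + 1) i = z k i + σ k * max (-(z k i) / lam k) (g i (x (k + 1)))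

/-- Parameter rules of the open-loop stepsize, with exponents `τ, p, γ`. -/
structure OpenLoop (τ p γ : ℝ) (α lam σ : ℕ → ℝ) : Prop where
  τ_mem : τ ∈ Set.Ioo (0 : ℝ) 1
  p_mem : p ∈ Set.Ioo τ 1
  γ_pos : 0 < γ
  lam_pos : ∀ k, 0 < lam k
  lam_strictMono : StrictMono lam
  lam_theta : lam =Θ[atTop] fun k : ℕ => (k : ℝ) ^ τ
  lam_diff : (fun k => lam (k + 1) - lam k) =O[atTop] fun k : ℕ => (k : ℝ) ^ (-(1 - τ))
  α_mem : ∀ k, α k ∈ Set.Ioc (0 : ℝ) 1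
  α_antitone : Antitone α
  α_theta : α =Θ[atTop] fun k : ℕ => (k : ℝ) ^ (-p)
  σ_pos : ∀ k, 0 < σ k
  σ_le : ∀ k, σ k ≤ lam k
  σ_theta : σ =Θ[atTop] fun k : ℕ => (k : ℝ) ^ (-(1 + γ))

/-! ### Uniformly convex sets -/

/-- `(ν, q)`-uniformly convex sets. -/
structure UniformlyConvexSet {n : ℕ} (ν q : ℝ) (D : Set (EuclideanSpace ℝ (Fin n))) : Prop where
  ν_pos : 0 < ν
  two_le_q : 2 ≤ q
  convex : Convex ℝ D
  ball_mem : ∀ x ∈ D, ∀ y ∈ D, ∀ t ∈ Set.Icc (0 : ℝ) 1, ∀ w : EuclideanSpace ℝ (Fin n), ‖w‖ = 1 →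
    t • x + (1 - t) • y + (t * (1 - t) * ν * ‖x - y‖ ^ q) • w ∈ D

/-- The set `𝓐_ε` of pairs `(x, z)` with `g x ≤ ε`, `z ≥ 0`, and `z i = 0` whenever
`g i x < -ε`. -/
def setA {n m : ℕ} (g : Fin m → EuclideanSpace ℝ (Fin n) → ℝ) (ε : ℝ) :
    Set (EuclideanSpace ℝ (Fin n) × EuclideanSpace ℝ (Fin m)) :=
  {P | (∀ i, g i P.1 ≤ ε) ∧ (∀ i, 0 ≤ P.2 i) ∧ ∀ i, g i P.1 < -ε → P.2 i = 0}

/-- The function `h` is the indicator of a compact `(ν, q)`-uniformly convex set `C`, and for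
some `ε > 0` the infimum of `‖∇f(x) + ∑ i, z i ∇(g i)(x)‖` over `(x, z) ∈ 𝓐_ε`, `x ∈ C`, is
positive. -/
structure UCAssumption {n m : ℕ} (f : EuclideanSpace ℝ (Fin n) → ℝ)
    (h : EuclideanSpace ℝ (Fin n) → EReal) (g : Fin m → EuclideanSpace ℝ (Fin n) → ℝ)
    (C : Set (EuclideanSpace ℝ (Fin n))) (ν q : ℝ) : Prop where
  h_eq : h = ind C
  compact : IsCompact C
  uniformlyConvex : UniformlyConvexSet ν q C
  grad_bound : ∃ ε : ℝ, 0 < ε ∧ ∃ ζ : ℝ, 0 < ζ ∧ ∀ x z, (x, z) ∈ setA g ε → x ∈ C →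
    ζ ≤ ‖gradient f x + ∑ i, z i • gradient (g i) x‖

/-! ### Rates -/

/-- The extended-real sequence `a` is finite and `a k = O(r k)` as `k → ∞`. -/
def HasRate (a : ℕ → EReal) (r : ℕ → ℝ) : Prop :=
  (∀ k, a k ≠ ⊥ ∧ a k ≠ ⊤) ∧ (fun k => (a k).toReal) =O[atTop] r

end

end CGAL

/-! Write `T` for the gap and `w i = max (g i x) (-z i / λ)`. The function `psi` is the minimum of
`λ s² / 2 + z s` over `s ≥ g i x`, attained at `w i`, and `w` is also the direction of the dual
step. Hence updating `λ` and `z` raises the augmented Lagrangian by at most `δ ∑ w²`, where `δ = (λ⁺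
- λ) / 2 + σ` (`IsRun.smoothPart_update`). Completing the square in the KKT saddle inequality gives
`λ / 4 ∑ w² ≤ T + K / λ` (`sum_sq_le_smoothPart`), so the update multiplies `T` by `1 + O(δ / λ)`
and adds `O(δ / λ²)`. Here `δ / λ = O(1 / k)`, which the contraction `α = Θ(k⁻ᵖ)`, `p < 1`, absorbs;
the term `δ / λ² = O(k^(-1-τ))` caps the rate at `1 - p + τ`.

A primal step subtracts `α G`, with `G ≥ T` the Frank-Wolfe gap, and adds a curvature term `c λ α²
‖v - x‖²`. Boundedness of `C` alone gives the rate `min (p - τ) (1 - p + τ)`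
(`IsRun.isBigO_gap_of_bounded`). Thus `T → 0`, the iterates with their multiplier estimates enter
`setA g ε`, the gradient stays away from `0`, and uniform convexity yields `G ≥ κ ‖v - x‖ ^ q`
(`IsRun.exists_eventually_rpow_le`). Half of `G` then pays for the curvature: entirely when `q = 2`,
since `λ α → 0`, and up to a remainder of order `α (λ α)^(1 + 2 / (q - 2))` when `q > 2`. For `q =
2` the gap is `O(k^(-τ))`, and the bound on `∑ w²` with the saddle inequality transfers this to
infeasibility and objective. -/

namespace CGAL

open Filter Asymptotics

/-! ### The function `psi` -/

/-- The quadratic `t w² / 2 + v w` has its vertex at `-v / t`, and `psi t u v` is its minimum over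
`w ≥ u`; `psi_eq` gives the minimizer. -/
theorem psi_le_of_le {t : ℝ} (ht : 0 < t) {u w : ℝ} (v : ℝ) (hw : u ≤ w) :
    psi t u v ≤ t * w ^ 2 / 2 + v * w := by
  have key : t * w ^ 2 / 2 + v * w = t / 2 * ((w + v / t) ^ 2 - (v / t) ^ 2) := by
    field_simp; ring
  rw [key, psi]
  have : (max (u + v / t) 0) ^ 2 ≤ (w + v / t) ^ 2 := by
    rcases max_cases (u + v / t) 0 with ⟨h, h'⟩ | ⟨h, h'⟩ <;> rw [h] <;> nlinarith
  gcongr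

theorem psi_eq {t : ℝ} (ht : 0 < t) (u v : ℝ) :
    psi t u v = t * (max u (-v / t)) ^ 2 / 2 + v * max u (-v / t) := by
  have h0 : max u (-v / t) + v / t = max (u + v / t) 0 := by
    rw [max_add]; congr 1; ring
  rw [psi, ← h0]; field_simp; ring

/-- Effect on `psi` of increasing the penalty and of changing the multiplier. -/
theorem psi_update {t t' : ℝ} (ht : 0 < t) (ht' : 0 < t') (u v v' : ℝ) :
    psi t' u v' ≤ psi t u v + (t' - t) / 2 * (max u (-v / t)) ^ 2
      + (v' - v) * max u (-v / t) := by
  -- The old minimizer remains admissible for the new penalty and multiplier.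
  have h1 := psi_le_of_le ht' v' (le_max_left u (-v / t))
  rw [psi_eq ht u v]; linarith

theorem psi_nonpos {t u v : ℝ} (ht : 0 < t) (hu : u ≤ 0) : psi t u v ≤ 0 := by
  simpa using psi_le_of_le ht v hu

theorem neg_sq_le_psi {t : ℝ} (ht : 0 < t) (u v : ℝ) : -(v ^ 2 / (2 * t)) ≤ psi t u v := by
  have : -(v ^ 2 / (2 * t)) = t / 2 * (0 - (v / t) ^ 2) := by field_simp; ring
  rw [this, psi]; gcongr; positivity

theorem max_mul_eq {t : ℝ} (ht : 0 < t) (u v : ℝ) :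
    max (t * u + v) 0 = t * max (u + v / t) 0 := by
  rw [mul_max_of_nonneg _ _ ht.le, mul_zero, mul_add, mul_div_cancel₀ _ ht.ne']

theorem sq_max_upper (a b : ℝ) :
    (max b 0) ^ 2 ≤ (max a 0) ^ 2 + 2 * max a 0 * (b - a) + (b - a) ^ 2 := by
  rcases max_cases a 0 with ⟨h, h'⟩ | ⟨h, h'⟩ <;> rcases max_cases b 0 with ⟨k, k'⟩ | ⟨k, k'⟩ <;>
    rw [h, k] <;> nlinarith

theorem sq_max_lower (a b : ℝ) :
    (max a 0) ^ 2 + 2 * max a 0 * (b - a) ≤ (max b 0) ^ 2 := by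
  rcases max_cases a 0 with ⟨h, h'⟩ | ⟨h, h'⟩ <;> rcases max_cases b 0 with ⟨k, k'⟩ | ⟨k, k'⟩ <;>
    rw [h, k] <;> nlinarith [sq_nonneg (b - a)]

theorem psi_upper {t : ℝ} (ht : 0 < t) (u u' v : ℝ) :
    psi t u' v ≤ psi t u v + max (t * u + v) 0 * (u' - u) + t / 2 * (u' - u) ^ 2 := by
  have h := sq_max_upper (u + v / t) (u' + v / t)
  rw [max_mul_eq ht, psi, psi]
  have := mul_le_mul_of_nonneg_left h (half_pos ht).le
  ring_nf at this ⊢; linarith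

theorem psi_lower {t : ℝ} (ht : 0 < t) (u u' v : ℝ) :
    psi t u v + max (t * u + v) 0 * (u' - u) ≤ psi t u' v := by
  have h := sq_max_lower (u + v / t) (u' + v / t)
  rw [max_mul_eq ht, psi, psi]
  have := mul_le_mul_of_nonneg_left h (half_pos ht).le
  ring_nf at this ⊢; linarith

theorem hasDerivAt_psi {t : ℝ} (ht : 0 < t) (u v : ℝ) :
    HasDerivAt (fun u => psi t u v) (max (t * u + v) 0) u := by
  rw [hasDerivAt_iff_isLittleO]
  -- `psi_lower` and `psi_upper` confine the linearization error to `[0, t / 2 * (y - u)²]`.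
  refine IsBigO.trans_isLittleO (g := fun y => (y - u) * (y - u)) ?_ ?_
  · refine IsBigO.of_bound (t / 2) (Eventually.of_forall fun y => ?_)
    have h1 := psi_upper ht u y v
    have h2 := psi_lower ht u y v
    rw [Real.norm_eq_abs, Real.norm_eq_abs, abs_mul_self, smul_eq_mul, abs_le]
    constructor <;> nlinarith [mul_nonneg ht.le (mul_self_nonneg (y - u))]
  · have h1 : (fun y => y - u) =o[nhds u] fun _ => (1 : ℝ) := by
      rw [isLittleO_one_iff]
      have : ContinuousAt (fun y : ℝ => y - u) u := by fun_prop
      simpa [ContinuousAt] using this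
    simpa using h1.mul_isBigO (isBigO_refl (fun y => y - u) (nhds u))

/-! ### Differentiable convex functions -/

variable {n m : ℕ}

theorem gradient_le_of_convexOn {f : EuclideanSpace ℝ (Fin n) → ℝ} (hc : ConvexOn ℝ Set.univ f)
    (hd : Differentiable ℝ f) (x y : EuclideanSpace ℝ (Fin n)) :
    f x + inner ℝ (gradient f x) (y - x) ≤ f y := by
  have hconv : ConvexOn ℝ Set.univ (fun t : ℝ => f (AffineMap.lineMap x y t)) := by
    have h1 := hc.comp_affineMap (AffineMap.lineMap x y : ℝ →ᵃ[ℝ] _)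
    rw [Set.preimage_univ] at h1
    exact h1
  have hder : HasDerivAt (fun t : ℝ => f (AffineMap.lineMap x y t))
      (inner ℝ (gradient f x) (y - x)) 0 := by
    have h1 : HasFDerivAt f (InnerProductSpace.toDual ℝ _ (gradient f x))
        (AffineMap.lineMap x y (0 : ℝ)) := by
      simpa using (hd x).hasGradientAt.hasFDerivAt
    exact h1.comp_hasDerivAt (0 : ℝ) (AffineMap.hasDerivAt_lineMap (a := x) (b := y))
  have := hconv.le_slope_of_hasDerivAt (Set.mem_univ 0) (Set.mem_univ 1) zero_lt_one hder
  rw [slope_def_field, AffineMap.lineMap_apply_one, AffineMap.lineMap_apply_zero] at this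
  linarith

/-- On a bounded set on which the gradient is Lipschitz, a convex function obeys uniform
bounds. -/
theorem exists_bounds {S : Set (EuclideanSpace ℝ (Fin n))} {f : EuclideanSpace ℝ (Fin n) → ℝ}
    (hc : ConvexOn ℝ Set.univ f) (hd : Differentiable ℝ f) {L D : ℝ} (hL : 0 < L)
    (hlip : ∀ x ∈ S, ∀ y ∈ S, ‖gradient f x - gradient f y‖ ≤ L * ‖x - y‖)
    (hD : ∀ x ∈ S, ∀ y ∈ S, ‖x - y‖ ≤ D) :
    ∃ M : ℝ, 0 ≤ M ∧ ∀ x ∈ S, ∀ y ∈ S, |f x| ≤ M ∧ |f y - f x| ≤ M * ‖y - x‖ ∧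
      f y ≤ f x + inner ℝ (gradient f x) (y - x) + M * ‖y - x‖ ^ 2 := by
  rcases S.eq_empty_or_nonempty with rfl | ⟨x₀, hx₀⟩
  · exact ⟨0, le_rfl, by simp⟩
  have hD0 : 0 ≤ D := (norm_nonneg _).trans (hD x₀ hx₀ x₀ hx₀)
  set G := ‖gradient f x₀‖ + L * D with hG
  have hG0 : 0 ≤ G := by positivity
  have hgrad : ∀ x ∈ S, ‖gradient f x‖ ≤ G := fun x hx => by
    have h1 := norm_sub_norm_le (gradient f x) (gradient f x₀)
    have h2 := hlip x hx x₀ hx₀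
    have h3 := mul_le_mul_of_nonneg_left (hD x hx x₀ hx₀) hL.le
    linarith
  have hdiff : ∀ x ∈ S, ∀ y ∈ S, |f y - f x| ≤ G * ‖y - x‖ := by
    intro x hx y hy
    have h1 := gradient_le_of_convexOn hc hd x y
    have h2 := gradient_le_of_convexOn hc hd y x
    have h3 := abs_le.1 (abs_real_inner_le_norm (gradient f x) (y - x))
    have h4 := abs_le.1 (abs_real_inner_le_norm (gradient f y) (x - y))
    have h5 := mul_le_mul_of_nonneg_right (hgrad x hx) (norm_nonneg (y - x))
    have h6 := mul_le_mul_of_nonneg_right (hgrad y hy) (norm_nonneg (x - y))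
    rw [norm_sub_rev x y] at h4 h6
    rw [abs_le]; constructor <;> linarith [h3.1, h4.1]
  refine ⟨|f x₀| + G * D + G + L, by positivity, fun x hx y hy => ⟨?_, ?_, ?_⟩⟩
  · have h1 := hdiff x₀ hx₀ x hx
    have h2 := mul_le_mul_of_nonneg_left (hD x hx x₀ hx₀) hG0
    have h3 := abs_sub_abs_le_abs_sub (f x) (f x₀)
    linarith
  · refine (hdiff x hx y hy).trans (mul_le_mul_of_nonneg_right ?_ (norm_nonneg _))
    have : 0 ≤ |f x₀| + G * D := by positivity
    linarith
  -- Convexity at `y` replaces integration along the segment: only gradients at the two endpoints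
  -- are compared, so `S` need not be convex.
  · have h1 := gradient_le_of_convexOn hc hd y x
    have h2 : inner ℝ (gradient f y - gradient f x) (y - x) ≤ L * ‖y - x‖ ^ 2 := by
      refine (real_inner_le_norm _ _).trans ?_
      have := mul_le_mul_of_nonneg_right (hlip y hy x hx) (norm_nonneg (y - x))
      linarith
    have h3 : inner ℝ (gradient f y) (x - y) = - inner ℝ (gradient f y) (y - x) := by
      rw [← inner_neg_right, neg_sub]
    rw [inner_sub_left] at h2
    have h4 : 0 ≤ (|f x₀| + G * D + G) * ‖y - x‖ ^ 2 := by positivity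
    linarith

/-! ### The smooth part of the augmented Lagrangian -/

/-- The multiplier estimates `[λ g i x + z i]₊`. -/
noncomputable def multiplier (g : Fin m → EuclideanSpace ℝ (Fin n) → ℝ) (lam : ℝ)
    (x : EuclideanSpace ℝ (Fin n)) (z : EuclideanSpace ℝ (Fin m)) : EuclideanSpace ℝ (Fin m) :=
  WithLp.toLp 2 fun i => max (lam * g i x + z i) 0

theorem multiplier_apply (g : Fin m → EuclideanSpace ℝ (Fin n) → ℝ) (lam : ℝ)
    (x : EuclideanSpace ℝ (Fin n)) (z : EuclideanSpace ℝ (Fin m)) (i : Fin m) :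
    multiplier g lam x z i = max (lam * g i x + z i) 0 := rfl

/-- This is the vector bounded below in `UCAssumption.grad_bound`, with `multiplier` in the role of
the dual variable. -/
theorem gradient_smoothPart {f : EuclideanSpace ℝ (Fin n) → ℝ}
    {g : Fin m → EuclideanSpace ℝ (Fin n) → ℝ} (hf : Differentiable ℝ f)
    (hg : ∀ i, Differentiable ℝ (g i)) {lam : ℝ} (hlam : 0 < lam)
    (x : EuclideanSpace ℝ (Fin n)) (z : EuclideanSpace ℝ (Fin m)) :
    gradient (fun y => smoothPart f g lam y z) x =
      gradient f x + ∑ i, multiplier g lam x z i • gradient (g i) x := by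
  apply HasGradientAt.gradient
  rw [hasGradientAt_iff_hasFDerivAt]
  have h1 : ∀ i, HasFDerivAt (fun y => psi lam (g i y) (z i))
      (multiplier g lam x z i • InnerProductSpace.toDual ℝ _ (gradient (g i) x)) x := fun i =>
    (hasDerivAt_psi hlam (g i x) (z i)).comp_hasFDerivAt x (hg i x).hasGradientAt.hasFDerivAt
  have h2 := (hf x).hasGradientAt.hasFDerivAt.add
    (HasFDerivAt.fun_sum fun i (_ : i ∈ Finset.univ) => h1 i)
  have h3 : InnerProductSpace.toDual ℝ _
      (gradient f x + ∑ i, multiplier g lam x z i • gradient (g i) x) =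
      InnerProductSpace.toDual ℝ _ (gradient f x) + ∑ i, multiplier g lam x z i •
        InnerProductSpace.toDual ℝ (EuclideanSpace ℝ (Fin n)) (gradient (g i) x) := by
    rw [map_add, map_sum]
    simp only [map_smulₛₗ]
    rfl
  rw [h3]
  exact h2

theorem inner_gradient_smoothPart {f : EuclideanSpace ℝ (Fin n) → ℝ}
    {g : Fin m → EuclideanSpace ℝ (Fin n) → ℝ} (hf : Differentiable ℝ f)
    (hg : ∀ i, Differentiable ℝ (g i)) {lam : ℝ} (hlam : 0 < lam)
    (x d : EuclideanSpace ℝ (Fin n)) (z : EuclideanSpace ℝ (Fin m)) :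
    inner ℝ (gradient (fun y => smoothPart f g lam y z) x) d =
      inner ℝ (gradient f x) d +
        ∑ i, max (lam * g i x + z i) 0 * inner ℝ (gradient (g i) x) d := by
  rw [gradient_smoothPart hf hg hlam, inner_add_left, sum_inner]
  simp [real_inner_smul_left, multiplier_apply]

theorem smoothPart_convex_lower {f : EuclideanSpace ℝ (Fin n) → ℝ}
    {g : Fin m → EuclideanSpace ℝ (Fin n) → ℝ}
    (hfc : ConvexOn ℝ Set.univ f) (hf : Differentiable ℝ f)
    (hgc : ∀ i, ConvexOn ℝ Set.univ (g i)) (hg : ∀ i, Differentiable ℝ (g i))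
    {lam : ℝ} (hlam : 0 < lam) (x y : EuclideanSpace ℝ (Fin n)) (z : EuclideanSpace ℝ (Fin m)) :
    smoothPart f g lam x z + inner ℝ (gradient (fun y => smoothPart f g lam y z) x) (y - x) ≤
      smoothPart f g lam y z := by
  rw [inner_gradient_smoothPart hf hg hlam, smoothPart, smoothPart]
  have h1 := gradient_le_of_convexOn hfc hf x y
  have h2 : ∑ i, psi lam (g i x) (z i) +
      ∑ i, max (lam * g i x + z i) 0 * inner ℝ (gradient (g i) x) (y - x) ≤
      ∑ i, psi lam (g i y) (z i) := by
    rw [← Finset.sum_add_distrib]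
    refine Finset.sum_le_sum fun i _ => ?_
    have h3 := gradient_le_of_convexOn (hgc i) (hg i) x y
    have h4 := psi_lower hlam (g i x) (g i y) (z i)
    have h5 := mul_le_mul_of_nonneg_left
      (show inner ℝ (gradient (g i) x) (y - x) ≤ g i y - g i x by linarith)
      (le_max_right (lam * g i x + z i) 0)
    linarith
  linarith

theorem smoothPart_le_of_feasible {f : EuclideanSpace ℝ (Fin n) → ℝ}
    {g : Fin m → EuclideanSpace ℝ (Fin n) → ℝ} {lam : ℝ} (hlam : 0 < lam)
    {x : EuclideanSpace ℝ (Fin n)} (z : EuclideanSpace ℝ (Fin m)) (hx : ∀ i, g i x ≤ 0) :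
    smoothPart f g lam x z ≤ f x := by
  have : ∑ i, psi lam (g i x) (z i) ≤ 0 := Finset.sum_nonpos fun i _ => psi_nonpos hlam (hx i)
  rw [smoothPart]; linarith

/-- Descent inequality for the smooth part, with a constant proportional to the penalty. -/
theorem exists_smoothPart_descent {S : Set (EuclideanSpace ℝ (Fin n))}
    {f : EuclideanSpace ℝ (Fin n) → ℝ} {g : Fin m → EuclideanSpace ℝ (Fin n) → ℝ}
    (hf : Differentiable ℝ f) (hg : ∀ i, Differentiable ℝ (g i)) {M : ℝ} (hM : 0 ≤ M)
    (hfM : ∀ x ∈ S, ∀ y ∈ S, f y ≤ f x + inner ℝ (gradient f x) (y - x) + M * ‖y - x‖ ^ 2)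
    (hgM : ∀ i, ∀ x ∈ S, ∀ y ∈ S, |g i x| ≤ M ∧ |g i y - g i x| ≤ M * ‖y - x‖ ∧
      g i y ≤ g i x + inner ℝ (gradient (g i) x) (y - x) + M * ‖y - x‖ ^ 2)
    {l Z : ℝ} (hl : 0 < l) (hZ : 0 ≤ Z) :
    ∃ c : ℝ, 0 < c ∧ ∀ lam, l ≤ lam → ∀ z : EuclideanSpace ℝ (Fin m), (∀ i, z i ≤ Z) →
      ∀ x ∈ S, ∀ y ∈ S, smoothPart f g lam y z ≤ smoothPart f g lam x z +
        inner ℝ (gradient (fun y => smoothPart f g lam y z) x) (y - x) +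
        c * lam * ‖y - x‖ ^ 2 := by
  -- `M / l` turns the curvature of `f` into a multiple of `lam ≥ l`. For each constraint, `(M + Z /
  -- l) * lam` bounds the slope of `psi`, which multiplies the curvature `M` of `g i`, and `M ^ 2 /
  -- 2` comes from `lam / 2 * (g i y - g i x) ^ 2`. The `1` ensures positivity.
  refine ⟨M / l + m * ((M + Z / l) * M + M ^ 2 / 2) + 1, by positivity, ?_⟩
  intro lam hlam z hz x hx y hy
  have hlam0 : 0 < lam := hl.trans_le hlam
  rw [inner_gradient_smoothPart hf hg hlam0, smoothPart, smoothPart]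
  have h1 := hfM x hx y hy
  set N := ‖y - x‖ with hN
  have hN0 : 0 ≤ N := norm_nonneg _
  have hdiv : ∀ a, 0 ≤ a → a ≤ a / l * lam := fun a ha => by
    rw [div_mul_eq_mul_div, le_div_iff₀ hl]; gcongr
  have h2 : ∑ i, psi lam (g i y) (z i) ≤ ∑ i, psi lam (g i x) (z i) +
      ∑ i, max (lam * g i x + z i) 0 * inner ℝ (gradient (g i) x) (y - x) +
      ∑ _i : Fin m, ((M + Z / l) * M + M ^ 2 / 2) * lam * N ^ 2 := by
    rw [← Finset.sum_add_distrib, ← Finset.sum_add_distrib]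
    refine Finset.sum_le_sum fun i _ => ?_
    obtain ⟨ha, hb, hc⟩ := hgM i x hx y hy
    have h4 := psi_upper hlam0 (g i x) (g i y) (z i)
    have hs0 := le_max_right (lam * g i x + z i) 0
    have hs : max (lam * g i x + z i) 0 ≤ (M + Z / l) * lam := by
      refine max_le ?_ (by positivity)
      have := mul_le_mul_of_nonneg_left ((le_abs_self _).trans ha) hlam0.le
      linarith [hz i, hdiv Z hZ]
    have h5 := mul_le_mul_of_nonneg_left
      (show g i y - g i x ≤ inner ℝ (gradient (g i) x) (y - x) + M * N ^ 2 by linarith) hs0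
    have h6 := mul_le_mul_of_nonneg_right hs (show 0 ≤ M * N ^ 2 by positivity)
    have h7 : (g i y - g i x) ^ 2 ≤ M ^ 2 * N ^ 2 := by
      rw [← mul_pow, ← sq_abs]; gcongr
    have h8 := mul_le_mul_of_nonneg_left h7 (half_pos hlam0).le
    linarith
  rw [Finset.sum_const, Finset.card_univ, Fintype.card_fin, nsmul_eq_mul] at h2
  have h9 := mul_le_mul_of_nonneg_right (hdiv M hM) (show 0 ≤ N ^ 2 by positivity)
  have h10 : 0 ≤ lam * N ^ 2 := by positivity
  linarith

/-- Lower bound for the smooth part from a saddle inequality at multipliers `zs`. -/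
theorem sum_sq_le_smoothPart {f : EuclideanSpace ℝ (Fin n) → ℝ}
    {g : Fin m → EuclideanSpace ℝ (Fin n) → ℝ} {x : EuclideanSpace ℝ (Fin n)}
    {zs : EuclideanSpace ℝ (Fin m)} {fs Z lam : ℝ} (hzs : ∀ i, 0 ≤ zs i)
    (hsad : fs ≤ f x + ∑ i, zs i * g i x) (hlam : 0 < lam)
    {z : EuclideanSpace ℝ (Fin m)} (hz0 : ∀ i, 0 ≤ z i) (hz : ∀ i, z i ≤ Z) :
    lam / 4 * ∑ i, (max (g i x) (-z i / lam)) ^ 2 ≤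
      smoothPart f g lam x z - fs + (∑ i, (Z + zs i) ^ 2) / lam := by
  have key : lam / 4 * ∑ i, (max (g i x) (-z i / lam)) ^ 2 ≤
      ∑ i, psi lam (g i x) (z i) - ∑ i, zs i * g i x + (∑ i, (Z + zs i) ^ 2) / lam := by
    rw [Finset.mul_sum, Finset.sum_div, ← Finset.sum_sub_distrib, ← Finset.sum_add_distrib]
    refine Finset.sum_le_sum fun i _ => ?_
    rw [psi_eq hlam]
    set w := max (g i x) (-z i / lam) with hw
    have h1 := mul_le_mul_of_nonneg_left (le_max_left (g i x) (-z i / lam)) (hzs i)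
    rw [← hw] at h1
    have h2 : (z i - zs i) ^ 2 ≤ (Z + zs i) ^ 2 := by
      apply sq_le_sq'  <;> linarith [hz0 i, hz i, hzs i]
    have h3 : (z i - zs i) ^ 2 / lam ≤ (Z + zs i) ^ 2 / lam := by gcongr
    -- Half of the term `lam / 2 * w ^ 2` in `psi` completes the square; the other half is the bound
    -- claimed.
    have h4 : 0 ≤ lam / 4 * w ^ 2 + (z i - zs i) * w + (z i - zs i) ^ 2 / lam := by
      have : lam / 4 * w ^ 2 + (z i - zs i) * w + (z i - zs i) ^ 2 / lam =
          lam * (w / 2 + (z i - zs i) / lam) ^ 2 := by field_simp; ring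
      rw [this]; positivity
    linarith
  rw [smoothPart]; linarith

end CGAL

namespace CGAL

open Filter Asymptotics

/-! ### Recurrences with polynomial coefficients -/

theorem isBigO_natCast_rpow {a b : ℝ} (hab : a ≤ b) :
    (fun k : ℕ => (k : ℝ) ^ a) =O[atTop] fun k : ℕ => (k : ℝ) ^ b := by
  refine IsBigO.of_bound 1 ?_
  filter_upwards [eventually_ge_atTop 1] with k hk
  have hk' : (1 : ℝ) ≤ k := by exact_mod_cast hk
  rw [one_mul, Real.norm_of_nonneg (by positivity), Real.norm_of_nonneg (by positivity)]
  exact Real.rpow_le_rpow_of_exponent_le hk' hab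

theorem tendsto_natCast_rpow_neg {a : ℝ} (ha : a < 0) :
    Tendsto (fun k : ℕ => (k : ℝ) ^ a) atTop (nhds 0) := by
  have := (tendsto_rpow_neg_atTop (neg_pos.2 ha)).comp (tendsto_natCast_atTop_atTop (R := ℝ))
  simpa [Function.comp_def] using this

theorem isBigO_mul_rpow {u v : ℕ → ℝ} {a b c : ℝ} (hu : u =O[atTop] fun k : ℕ => (k : ℝ) ^ a)
    (hv : v =O[atTop] fun k : ℕ => (k : ℝ) ^ b) (hc : a + b = c) :
    (fun k => u k * v k) =O[atTop] fun k : ℕ => (k : ℝ) ^ c := by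
  refine (hu.mul hv).congr' EventuallyEq.rfl ?_
  filter_upwards [eventually_ge_atTop 1] with k hk
  rw [← Real.rpow_add (by exact_mod_cast hk), hc]

theorem isBigO_inv_rpow {u : ℕ → ℝ} {a : ℝ} (hu : (fun k : ℕ => (k : ℝ) ^ a) =O[atTop] u) :
    (fun k => (u k)⁻¹) =O[atTop] fun k : ℕ => (k : ℝ) ^ (-a) := by
  refine (hu.inv_rev ?_).congr' EventuallyEq.rfl ?_
  · filter_upwards [eventually_ge_atTop 1] with k hk h0
    have : (0 : ℝ) < (k : ℝ) ^ a := Real.rpow_pos_of_pos (by exact_mod_cast hk) _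
    exact absurd h0 this.ne'
  · filter_upwards with k
    rw [Real.rpow_neg (Nat.cast_nonneg _)]

theorem isBigO_rpow_rpow {u : ℕ → ℝ} {a b c : ℝ} (hb : 0 ≤ b)
    (hu : u =O[atTop] fun k : ℕ => (k : ℝ) ^ a) (hc : a * b = c) :
    (fun k => u k ^ b) =O[atTop] fun k : ℕ => (k : ℝ) ^ c := by
  have h := hu.rpow hb (Eventually.of_forall fun k => by positivity)
  refine h.congr' EventuallyEq.rfl ?_
  filter_upwards with k
  rw [← Real.rpow_mul (Nat.cast_nonneg _), hc]

/-- If `T (k + 1) ≤ (1 - c k⁻ᵖ) T k + B k⁻ᵖ⁻ʳ` with `p < 1`, then `T k = O(k⁻ʳ)`. -/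
theorem isBigO_of_linear_recurrence {T : ℕ → ℝ} {p r c B : ℝ} (hp0 : 0 < p) (hp : p < 1)
    (hr : 0 < r) (hc : 0 < c) (hB : 0 ≤ B) (hT0 : ∀ k, 0 ≤ T k)
    (hT : ∀ᶠ k : ℕ in atTop,
      T (k + 1) ≤ (1 - c * (k : ℝ) ^ (-p)) * T k + B * (k : ℝ) ^ (-(p + r))) :
    T =O[atTop] fun k : ℕ => (k : ℝ) ^ (-r) := by
  have e1 : ∀ᶠ k : ℕ in atTop, (k : ℝ) ^ (-p) < 1 / c :=
    (tendsto_natCast_rpow_neg (by linarith)).eventually_lt_const (by positivity)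
  have e2 : ∀ᶠ k : ℕ in atTop, (k : ℝ) ^ (p - 1) < c / (2 * r) :=
    (tendsto_natCast_rpow_neg (by linarith)).eventually_lt_const (by positivity)
  obtain ⟨k₀, hk₀⟩ := eventually_atTop.1 ((hT.and e1).and (e2.and (eventually_ge_atTop 1)))
  have hk₀pos : (0 : ℝ) < k₀ := by exact_mod_cast (hk₀ k₀ le_rfl).2.2
  -- The first entry gives `B ≤ A c / 2`, so half of the contraction absorbs `B`; the second is the
  -- base case.
  set A := max (2 * B / c) (T k₀ * (k₀ : ℝ) ^ r) with hA
  have hA1 : 2 * B / c ≤ A := le_max_left _ _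
  have hA0 : 0 ≤ A := le_trans (by positivity) hA1
  have main : ∀ k, k₀ ≤ k → T k ≤ A * (k : ℝ) ^ (-r) := by
    intro k hk
    induction k, hk using Nat.le_induction with
    | base =>
      have h1 : T k₀ * (k₀ : ℝ) ^ r ≤ A := le_max_right _ _
      rw [Real.rpow_neg hk₀pos.le, ← div_eq_mul_inv, le_div_iff₀ (by positivity)]
      exact h1
    | succ k hk ih =>
      obtain ⟨⟨h1, h2⟩, h3, h4⟩ := hk₀ k hk
      have hkpos : (0 : ℝ) < k := by exact_mod_cast h4
      set P := (k : ℝ) ^ (-p) with hP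
      set R := (k : ℝ) ^ (-r) with hR
      have hP0 : 0 < P := by positivity
      have hR0 : 0 < R := by positivity
      have hcP : c * P ≤ 1 := by
        rw [lt_div_iff₀ hc] at h2; linarith
      have hPR : (k : ℝ) ^ (-(p + r)) = P * R := by
        rw [hP, hR, ← Real.rpow_add hkpos]; ring_nf
      -- The other half of the contraction covers the relative decrease `r / k` of `k⁻ʳ`, because `p
      -- < 1`.
      have hinv : r * (k : ℝ)⁻¹ ≤ c * P / 2 := by
        have : (k : ℝ)⁻¹ = (k : ℝ) ^ (p - 1) * P := by
          rw [hP, ← Real.rpow_add hkpos, ← Real.rpow_neg_one]; ring_nf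
        rw [this]
        rw [lt_div_iff₀ (by positivity)] at h3
        nlinarith
      have hstep : (1 - r * (k : ℝ)⁻¹) * R ≤ ((k + 1 : ℕ) : ℝ) ^ (-r) := by
        have h5 : ((k + 1 : ℕ) : ℝ) = k * (1 + (k : ℝ)⁻¹) := by
          push_cast; field_simp
        rw [h5, Real.mul_rpow hkpos.le (by positivity), mul_comm]
        refine mul_le_mul_of_nonneg_left ?_ hR0.le
        rw [Real.rpow_def_of_pos (by positivity)]
        have h6 : Real.log (1 + (k : ℝ)⁻¹) ≤ (k : ℝ)⁻¹ := by
          have := Real.log_le_sub_one_of_pos (show 0 < 1 + (k : ℝ)⁻¹ by positivity)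
          linarith
        have h7 := Real.add_one_le_exp (Real.log (1 + (k : ℝ)⁻¹) * -r)
        nlinarith
      rw [hPR] at h1
      have h8 : (1 - c * P) * T k ≤ (1 - c * P) * (A * R) :=
        mul_le_mul_of_nonneg_left ih (by linarith)
      have h9 : A * ((1 - r * (k : ℝ)⁻¹) * R) ≤ A * ((k + 1 : ℕ) : ℝ) ^ (-r) :=
        mul_le_mul_of_nonneg_left hstep hA0
      have h10 : B ≤ A * c / 2 := by
        rw [div_le_iff₀ hc] at hA1; linarith
      have h11 := mul_le_mul_of_nonneg_right h10 (mul_pos hP0 hR0).le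
      have h12 := mul_le_mul_of_nonneg_right hinv (mul_nonneg hA0 hR0.le)
      linarith
  refine IsBigO.of_bound A ?_
  filter_upwards [eventually_ge_atTop k₀] with k hk
  rw [Real.norm_of_nonneg (hT0 k), Real.norm_of_nonneg (by positivity)]
  exact main k hk

/-- Rate of the optimality gap from a decrease estimate of the primal step, under the parameter
rules of the open-loop stepsize. -/
theorem OpenLoop.isBigO_of_step {τ p γ : ℝ} {α lam σ : ℕ → ℝ} (hl : OpenLoop τ p γ α lam σ)
    {T B R : ℕ → ℝ} {K r : ℝ} (hT0 : ∀ k, 0 ≤ T k)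
    (hstep : ∀ k, T (k + 1) ≤ (1 + 4 * (((lam (k + 1) - lam k) / 2 + σ k) * (lam k)⁻¹)) * B k
      + K * (((lam (k + 1) - lam k) / 2 + σ k) * (lam k)⁻¹ * (lam k)⁻¹))
    (hB : ∀ᶠ k in atTop, B k ≤ (1 - α k / 2) * T k + R k)
    (hR : R =O[atTop] fun k : ℕ => (k : ℝ) ^ (-(p + r))) (hr : 0 < r) (hr' : r ≤ 1 - p + τ) :
    T =O[atTop] fun k : ℕ => (k : ℝ) ^ (-r) := by
  obtain ⟨hτ0, hτ1⟩ := hl.τ_mem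
  obtain ⟨hp0, hp1⟩ := hl.p_mem
  have hγ := hl.γ_pos
  have hinv : (fun k => (lam k)⁻¹) =O[atTop] fun k : ℕ => (k : ℝ) ^ (-τ) :=
    isBigO_inv_rpow hl.lam_theta.isBigO_symm
  have hδ : (fun k => (lam (k + 1) - lam k) / 2 + σ k) =O[atTop]
      fun k : ℕ => (k : ℝ) ^ (-(1 - τ)) := by
    refine IsBigO.add ?_ (hl.σ_theta.isBigO.trans (isBigO_natCast_rpow (by linarith)))
    simpa [div_eq_inv_mul] using hl.lam_diff.const_mul_left (2⁻¹ : ℝ)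
  -- The exponents `1 - τ` and `τ` add up to `1`, whatever `τ` is.
  have hδ1 := isBigO_mul_rpow hδ hinv (c := -1) (by ring)
  have hδ2 := isBigO_mul_rpow hδ1 hinv (c := -1 - τ) (by ring)
  obtain ⟨a, ha, hα⟩ := hl.α_theta.isBigO_symm.exists_pos
  obtain ⟨e, he, hδ1⟩ := hδ1.exists_pos
  obtain ⟨b, hb, hδ2⟩ :=
    -- The cap `r ≤ 1 - p + τ` is exactly `p + r ≤ 1 + τ`.
    (hδ2.trans (isBigO_natCast_rpow (show -1 - τ ≤ -(p + r) by linarith))).exists_pos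
  obtain ⟨d, hd, hR⟩ := hR.exists_pos
  -- This threshold makes `4 * δ1 ≤ α k / 4`, so of the contraction `α k / 2` at least `α k / 4 ≥ P
  -- / (4 * a)` survives.
  have s1 : ∀ᶠ k : ℕ in atTop, (k : ℝ) ^ (p - 1) < 1 / (16 * e * a) :=
    (tendsto_natCast_rpow_neg (by linarith)).eventually_lt_const (by positivity)
  refine isBigO_of_linear_recurrence (c := 1 / (4 * a)) (B := 2 * d + |K| * b) (hτ0.trans hp0) hp1
    hr (by positivity) (by positivity) hT0 ?_
  filter_upwards [hα.bound, hδ1.bound, hδ2.bound, hR.bound, hB, s1, eventually_ge_atTop 1]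
    with k hα hδ1 hδ2 hR hB hs hk
  have hkpos : (0 : ℝ) < k := by exact_mod_cast hk
  have hαk := hl.α_mem k
  have hstep := hstep k
  rw [Real.norm_of_nonneg (by positivity), Real.norm_of_nonneg hαk.1.le] at hα
  have hδ0 : 0 ≤ (lam (k + 1) - lam k) / 2 + σ k := by
    have := hl.lam_strictMono (Nat.lt_succ_self k)
    have := hl.σ_pos k
    simp only [Nat.succ_eq_add_one] at *
    linarith
  have hlam := hl.lam_pos k
  set δ1 := ((lam (k + 1) - lam k) / 2 + σ k) * (lam k)⁻¹ with hδ1def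
  have hδ1n : 0 ≤ δ1 := by positivity
  rw [Real.norm_of_nonneg hδ1n, Real.norm_of_nonneg (by positivity)] at hδ1
  rw [Real.norm_of_nonneg (by positivity), Real.norm_of_nonneg (by positivity)] at hδ2
  rw [Real.norm_eq_abs, Real.norm_of_nonneg (by positivity)] at hR
  set P := (k : ℝ) ^ (-p) with hP
  set Q := (k : ℝ) ^ (-(p + r)) with hQ
  have hP0 : 0 < P := by positivity
  have hQ0 : 0 < Q := by positivity
  have hk1 : (k : ℝ) ^ (-1 : ℝ) = (k : ℝ) ^ (p - 1) * P := by
    rw [hP, ← Real.rpow_add hkpos]; ring_nf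
  have hαlow : P / a ≤ α k := by rw [div_le_iff₀ ha]; linarith
  have hδα : 4 * δ1 ≤ α k / 4 := by
    have h1 : e * ((k : ℝ) ^ (p - 1) * P) ≤ e * (1 / (16 * e * a) * P) := by gcongr
    have h2 : e * (1 / (16 * e * a) * P) = P / a / 16 := by field_simp
    rw [hk1] at hδ1
    linarith
  have hB2 : (1 + 4 * δ1) * B k ≤ (1 + 4 * δ1) * ((1 - α k / 2) * T k + R k) := by gcongr
  have hcoef : (1 + 4 * δ1) * (1 - α k / 2) ≤ 1 - 1 / (4 * a) * P := by
    have h3 : 1 / (4 * a) * P = P / a / 4 := by field_simp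
    have h4 : 0 ≤ δ1 * α k := mul_nonneg hδ1n hαk.1.le
    rw [h3]; linarith
  have h5 := mul_le_mul_of_nonneg_right hcoef (hT0 k)
  have h6 : (1 + 4 * δ1) * R k ≤ 2 * (d * Q) := by
    have h7 : (1 + 4 * δ1) * R k ≤ (1 + 4 * δ1) * (d * Q) :=
      mul_le_mul_of_nonneg_left ((le_abs_self _).trans hR) (by positivity)
    have h8 : (1 + 4 * δ1) * (d * Q) ≤ 2 * (d * Q) := by
      gcongr; linarith [hαk.2]
    linarith
  have h9 : K * (δ1 * (lam k)⁻¹) ≤ |K| * (b * Q) := by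
    refine (mul_le_mul_of_nonneg_right (le_abs_self K) (by positivity)).trans ?_
    gcongr
  linarith

end CGAL

namespace CGAL

open Filter Asymptotics

variable {n m : ℕ}

/-! ### Indicator functions and uniformly convex sets -/

theorem ind_of_mem {C : Set (EuclideanSpace ℝ (Fin n))} {x : EuclideanSpace ℝ (Fin n)}
    (hx : x ∈ C) : ind C x = 0 := by simp [ind, hx]

theorem ind_of_notMem {C : Set (EuclideanSpace ℝ (Fin n))} {x : EuclideanSpace ℝ (Fin n)}
    (hx : x ∉ C) : ind C x = ⊤ := by simp [ind, hx]

theorem dom_ind (C : Set (EuclideanSpace ℝ (Fin n))) : dom (ind C) = C := by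
  ext x
  by_cases hx : x ∈ C
  · simp [dom, ind_of_mem hx, hx]
  · simp [dom, ind_of_notMem hx, hx]

theorem IsLMO.mem {C : Set (EuclideanSpace ℝ (Fin n))} (hC : C.Nonempty)
    {u v : EuclideanSpace ℝ (Fin n)} (h : IsLMO (ind C) u v) : v ∈ C := by
  by_contra hv
  obtain ⟨y, hy⟩ := hC
  have := h y
  rw [ind_of_notMem hv, ind_of_mem hy, EReal.coe_add_top, add_zero, top_le_iff] at this
  exact EReal.coe_ne_top _ this

theorem IsLMO.inner_le {C : Set (EuclideanSpace ℝ (Fin n))}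
    {u v w : EuclideanSpace ℝ (Fin n)} (h : IsLMO (ind C) u v) (hw : w ∈ C) :
    inner ℝ u v ≤ inner ℝ u w := by
  have h1 := h w
  rw [ind_of_mem (h.mem ⟨w, hw⟩), ind_of_mem hw, add_zero, add_zero] at h1
  exact_mod_cast h1

/-- Over a uniformly convex set, the linear minimization gap controls the distance to the
minimizer. -/
theorem UniformlyConvexSet.le_inner {ν q : ℝ} {C : Set (EuclideanSpace ℝ (Fin n))}
    (hC : UniformlyConvexSet ν q C) {u v x : EuclideanSpace ℝ (Fin n)} (h : IsLMO (ind C) u v)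
    (hx : x ∈ C) : ν / 2 * ‖u‖ * ‖v - x‖ ^ q ≤ inner ℝ u (x - v) := by
  rcases eq_or_ne u 0 with rfl | hu
  · simp
  have hu' : ‖u‖ ≠ 0 := norm_ne_zero_iff.2 hu
  -- The midpoint of `x` and `v`, pushed by `ν / 4 * ‖x - v‖ ^ q` along `-u / ‖u‖`, stays in `C`;
  -- minimality of `v` is tested against it.
  have hmem := hC.ball_mem x hx v (h.mem ⟨x, hx⟩) (1 / 2) ⟨by norm_num, by norm_num⟩
    (-(‖u‖⁻¹ • u)) (by rw [norm_neg, norm_smul, norm_inv, norm_norm, inv_mul_cancel₀ hu'])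
  have h1 := h.inner_le hmem
  rw [inner_add_right, inner_add_right, real_inner_smul_right, real_inner_smul_right,
    real_inner_smul_right, inner_neg_right, real_inner_smul_right,
    real_inner_self_eq_norm_sq, norm_sub_rev x v] at h1
  have h2 : ‖u‖⁻¹ * ‖u‖ ^ 2 = ‖u‖ := by field_simp
  rw [h2] at h1
  rw [inner_sub_right]
  linarith

/-! ### Consequences of the KKT conditions -/

theorem IsKKT.mem {f : EuclideanSpace ℝ (Fin n) → ℝ} {g : Fin m → EuclideanSpace ℝ (Fin n) → ℝ}
    {C : Set (EuclideanSpace ℝ (Fin n))} (hC : C.Nonempty) {xs : EuclideanSpace ℝ (Fin n)}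
    {zs : EuclideanSpace ℝ (Fin m)} (hk : IsKKT f (ind C) g xs zs) : xs ∈ C := by
  by_contra hx
  obtain ⟨ξ, hξ, -⟩ := hk.stationary
  obtain ⟨y, hy⟩ := hC
  have := hξ y
  rw [ind_of_notMem hx, ind_of_mem hy, EReal.top_add_coe, top_le_iff] at this
  exact EReal.zero_ne_top this

/-- The Lagrangian with multipliers `zs` is convex and stationary at `xs` relative to `C`, and
complementarity removes the constraint terms at `xs`. -/
theorem IsKKT.saddle {f : EuclideanSpace ℝ (Fin n) → ℝ}
    {g : Fin m → EuclideanSpace ℝ (Fin n) → ℝ} {C : Set (EuclideanSpace ℝ (Fin n))}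
    {xs y : EuclideanSpace ℝ (Fin n)} {zs : EuclideanSpace ℝ (Fin m)}
    (hk : IsKKT f (ind C) g xs zs) (hs : StandingAssumption f (ind C) g) (hy : y ∈ C) :
    f xs ≤ f y + ∑ i, zs i * g i y := by
  obtain ⟨ξ, hξ, hst⟩ := hk.stationary
  have h1 := hξ y
  rw [ind_of_mem (hk.mem ⟨y, hy⟩), ind_of_mem hy, zero_add] at h1
  have h1 : inner ℝ ξ (y - xs) ≤ 0 := by exact_mod_cast h1
  have h2 := gradient_le_of_convexOn hs.f_convex hs.f_differentiable xs y
  have h3 : ∑ i, zs i * g i xs + ∑ i, zs i * inner ℝ (gradient (g i) xs) (y - xs) ≤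
      ∑ i, zs i * g i y := by
    rw [← Finset.sum_add_distrib]
    refine Finset.sum_le_sum fun i _ => ?_
    rw [← mul_add]
    exact mul_le_mul_of_nonneg_left
      (gradient_le_of_convexOn (hs.g_convex i) (hs.g_differentiable i) xs y) (hk.dual_nonneg i)
  have h4 := congrArg (fun u => inner ℝ u (y - xs)) hst
  simp only [inner_add_left, sum_inner, real_inner_smul_left, inner_zero_left] at h4
  rw [hk.complementary] at h3
  linarith

theorem IsKKT.optValue_eq {f : EuclideanSpace ℝ (Fin n) → ℝ}
    {g : Fin m → EuclideanSpace ℝ (Fin n) → ℝ} {C : Set (EuclideanSpace ℝ (Fin n))}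
    {xs : EuclideanSpace ℝ (Fin n)} {zs : EuclideanSpace ℝ (Fin m)}
    (hk : IsKKT f (ind C) g xs zs) (hs : StandingAssumption f (ind C) g) (hC : C.Nonempty) :
    optValue f (ind C) g = (f xs : EReal) := by
  refine le_antisymm ?_ ?_
  · refine (iInf₂_le xs hk.feasible).trans ?_
    rw [ind_of_mem (hk.mem hC), add_zero]
  · refine le_iInf₂ fun y hy => ?_
    by_cases hyC : y ∈ C
    · rw [ind_of_mem hyC, add_zero, EReal.coe_le_coe_iff]
      have h1 := hk.saddle hs hyC
      have h2 : ∑ i, zs i * g i y ≤ 0 := Finset.sum_nonpos fun i _ =>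
        mul_nonpos_of_nonneg_of_nonpos (hk.dual_nonneg i) (hy i)
      linarith
    · rw [ind_of_notMem hyC, EReal.coe_add_top]
      exact le_top

/-! ### Iterates of the algorithm -/

variable {f : EuclideanSpace ℝ (Fin n) → ℝ} {g : Fin m → EuclideanSpace ℝ (Fin n) → ℝ}
  {C : Set (EuclideanSpace ℝ (Fin n))} {α lam σ : ℕ → ℝ} {x v : ℕ → EuclideanSpace ℝ (Fin n)}
  {z : ℕ → EuclideanSpace ℝ (Fin m)}

theorem IsRun.nonempty (hr : IsRun f (ind C) g α lam σ x z v) : C.Nonempty :=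
  ⟨x 0, by simpa only [dom_ind] using hr.x_zero⟩

theorem IsRun.v_mem (hr : IsRun f (ind C) g α lam σ x z v) (k : ℕ) : v k ∈ C :=
  (hr.v_step k).mem hr.nonempty

theorem IsRun.x_mem (hr : IsRun f (ind C) g α lam σ x z v) (hC : Convex ℝ C) (k : ℕ) :
    x k ∈ C := by
  induction k with
  | zero => simpa only [dom_ind] using hr.x_zero
  | succ k ih =>
    rw [hr.x_step]
    exact hC.add_smul_sub_mem ih (hr.v_mem k) (hr.α_mem k)

/-- Since `σ ≤ λ`, a dual step towards `-z / λ` shrinks `z` by the factor `1 - σ / λ ≥ 0` at worst.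
-/
theorem IsRun.z_nonneg (hr : IsRun f (ind C) g α lam σ x z v) (k : ℕ) (i : Fin m) :
    0 ≤ z k i := by
  induction k with
  | zero => exact hr.z_zero i
  | succ k ih =>
    rw [hr.z_step]
    have hl := hr.lam_pos k
    have h1 := mul_le_mul_of_nonneg_left (le_max_left (-(z k i) / lam k) (g i (x (k + 1))))
      (hr.σ_pos k).le
    have h2 : z k i + σ k * (-(z k i) / lam k) = z k i * ((lam k - σ k) / lam k) := by
      field_simp; ring
    have h3 : 0 ≤ z k i * ((lam k - σ k) / lam k) :=
      mul_nonneg ih (div_nonneg (by linarith [hr.σ_le k]) hl.le)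
    linarith

/-- Each dual step raises a multiplier by at most `σ k * M`, and `σ` is summable. -/
theorem IsRun.exists_z_le (hr : IsRun f (ind C) g α lam σ x z v) (hC : Convex ℝ C) {M : ℝ}
    (hM : 0 ≤ M) (hg : ∀ i, ∀ y ∈ C, g i y ≤ M) :
    ∃ Z, 0 ≤ Z ∧ ∀ k i, z k i ≤ Z := by
  have h1 : ∀ k i, z k i ≤ z 0 i + M * ∑ j ∈ Finset.range k, σ j := by
    intro k i
    induction k with
    | zero => simp
    | succ k ih =>
      rw [hr.z_step, Finset.sum_range_succ]
      have h2 : max (-(z k i) / lam k) (g i (x (k + 1))) ≤ M := by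
        refine max_le ?_ (hg i _ (hr.x_mem hC _))
        have : -(z k i) / lam k ≤ 0 :=
          div_nonpos_of_nonpos_of_nonneg (by linarith [hr.z_nonneg k i]) (hr.lam_pos k).le
        linarith
      have h3 := mul_le_mul_of_nonneg_left h2 (hr.σ_pos k).le
      linarith
  have hσ : ∀ k, ∑ j ∈ Finset.range k, σ j ≤ ∑' j, σ j := fun k =>
    hr.σ_summable.sum_le_tsum _ fun j _ => (hr.σ_pos j).le
  have hσ0 : 0 ≤ ∑' j, σ j := tsum_nonneg fun j => (hr.σ_pos j).le
  refine ⟨∑ i, z 0 i + M * ∑' j, σ j,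
    add_nonneg (Finset.sum_nonneg fun i _ => hr.z_zero i) (mul_nonneg hM hσ0), fun k i => ?_⟩
  have h4 := Finset.single_le_sum (f := fun i => z 0 i) (fun i _ => hr.z_zero i)
    (Finset.mem_univ i)
  have h5 := mul_le_mul_of_nonneg_left (hσ k) hM
  simp only at h4
  linarith [h1 k i]

/-- Uniform bounds for the objective and the constraints on the feasible set of the linear
minimization oracle. -/
theorem StandingAssumption.exists_bounds (hs : StandingAssumption f (ind C) g) :
    ∃ M : ℝ, 0 ≤ M ∧
      (∀ x ∈ C, ∀ y ∈ C, f y ≤ f x + inner ℝ (gradient f x) (y - x) + M * ‖y - x‖ ^ 2) ∧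
      ∀ i, ∀ x ∈ C, ∀ y ∈ C, |g i x| ≤ M ∧ |g i y - g i x| ≤ M * ‖y - x‖ ∧
        g i y ≤ g i x + inner ℝ (gradient (g i) x) (y - x) + M * ‖y - x‖ ^ 2 := by
  obtain ⟨D, -, hD⟩ := hs.h_bounded
  have hgl := hs.g_lipschitz
  rw [dom_ind] at hD hgl
  obtain ⟨Lf, hLf, hfl⟩ := hs.f_lipschitz
  obtain ⟨Mf, hMf, hf⟩ := CGAL.exists_bounds (S := C) hs.f_convex hs.f_differentiable hLf
    (fun x _ y _ => hfl x y) hD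
  have : ∀ i, ∃ M : ℝ, 0 ≤ M ∧ ∀ x ∈ C, ∀ y ∈ C, |g i x| ≤ M ∧ |g i y - g i x| ≤ M * ‖y - x‖ ∧
      g i y ≤ g i x + inner ℝ (gradient (g i) x) (y - x) + M * ‖y - x‖ ^ 2 := fun i => by
    obtain ⟨L, hL, hl⟩ := hgl i
    exact CGAL.exists_bounds (hs.g_convex i) (hs.g_differentiable i) hL hl hD
  choose Mg hMg hg using this
  have hsum0 : 0 ≤ ∑ i, Mg i := Finset.sum_nonneg fun i _ => hMg i
  refine ⟨Mf + ∑ i, Mg i, add_nonneg hMf hsum0, fun x hx y hy => ?_, fun i x hx y hy => ?_⟩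
  · have := (hf x hx y hy).2.2
    have h2 : 0 ≤ (∑ i, Mg i) * ‖y - x‖ ^ 2 := by positivity
    linarith
  · obtain ⟨h1, h2, h3⟩ := hg i x hx y hy
    have hle : Mg i ≤ Mf + ∑ i, Mg i := by
      have := Finset.single_le_sum (f := Mg) (fun i _ => hMg i) (Finset.mem_univ i)
      linarith
    have h4 := mul_le_mul_of_nonneg_right hle (norm_nonneg (y - x))
    have h5 := mul_le_mul_of_nonneg_right hle (sq_nonneg ‖y - x‖)
    exact ⟨h1.trans hle, h2.trans h4, by linarith⟩

/-- The Frank-Wolfe gap of the augmented Lagrangian dominates the optimality gap. -/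
theorem IsRun.gap_le (hr : IsRun f (ind C) g α lam σ x z v) (hs : StandingAssumption f (ind C) g)
    {xs : EuclideanSpace ℝ (Fin n)} (hxs : xs ∈ C) (hfeas : ∀ i, g i xs ≤ 0) (k : ℕ) :
    smoothPart f g (lam k) (x k) (z k) - f xs ≤
      inner ℝ (gradient (fun y => smoothPart f g (lam k) y (z k)) (x k)) (x k - v k) := by
  have h1 := smoothPart_convex_lower hs.f_convex hs.f_differentiable hs.g_convex
    hs.g_differentiable (hr.lam_pos k) (x k) xs (z k)
  have h2 := smoothPart_le_of_feasible (f := f) (hr.lam_pos k) (z k) hfeas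
  have h3 := (hr.v_step k).inner_le hxs
  rw [inner_sub_right] at h1 ⊢
  linarith

/-- Change of the augmented Lagrangian under the updates of the penalty and the multipliers. -/
theorem IsRun.smoothPart_update (hr : IsRun f (ind C) g α lam σ x z v) (k : ℕ) :
    smoothPart f g (lam (k + 1)) (x (k + 1)) (z (k + 1)) ≤
      smoothPart f g (lam k) (x (k + 1)) (z k) + ((lam (k + 1) - lam k) / 2 + σ k) *
        ∑ i, (max (g i (x (k + 1))) (-z k i / lam k)) ^ 2 := by
  rw [smoothPart, smoothPart, Finset.mul_sum, add_assoc, ← Finset.sum_add_distrib]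
  gcongr with i
  have h1 := psi_update (hr.lam_pos k) (hr.lam_pos (k + 1)) (g i (x (k + 1))) (z k i)
    (z (k + 1) i)
  -- The dual increment is `σ k` times the same maximum as in `psi_update`, so its effect is again a
  -- square.
  have h2 := hr.z_step k i
  rw [max_comm] at h2
  rw [h2] at h1 ⊢
  linarith

/-- The updates cost `δ ∑ w²`, and `hK` bounds `∑ w²` by `4 / λ` times the gap plus `4 K / λ²`. The
cost is thus essentially proportional to the gap itself. -/
theorem IsRun.gap_succ_le (hr : IsRun f (ind C) g α lam σ x z v) {fs K : ℝ} (k : ℕ)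
    (hK : lam k / 4 * ∑ i, (max (g i (x (k + 1))) (-z k i / lam k)) ^ 2 ≤
      smoothPart f g (lam k) (x (k + 1)) (z k) - fs + K / lam k) (hK0 : 0 ≤ K) :
    max (smoothPart f g (lam (k + 1)) (x (k + 1)) (z (k + 1)) - fs) 0 ≤
      (1 + 4 * (((lam (k + 1) - lam k) / 2 + σ k) * (lam k)⁻¹)) *
        max (smoothPart f g (lam k) (x (k + 1)) (z k) - fs) 0 +
      4 * K * (((lam (k + 1) - lam k) / 2 + σ k) * (lam k)⁻¹ * (lam k)⁻¹) := by
  have hl := hr.lam_pos k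
  have h1 := hr.smoothPart_update k
  have hδ0 : 0 ≤ (lam (k + 1) - lam k) / 2 + σ k := by
    have h2 := hr.lam_strictMono (Nat.lt_add_one k)
    have h3 := hr.σ_pos k
    linarith
  set δ := (lam (k + 1) - lam k) / 2 + σ k
  set S := ∑ i, (max (g i (x (k + 1))) (-z k i / lam k)) ^ 2
  set B := smoothPart f g (lam k) (x (k + 1)) (z k) - fs with hB
  have hB1 := le_max_left B 0
  have hB0 := le_max_right B 0
  have hS : S ≤ 4 * (lam k)⁻¹ * max B 0 + 4 * K * (lam k)⁻¹ * (lam k)⁻¹ := by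
    have h4 : lam k / 4 * S ≤ max B 0 + K / lam k := by linarith
    have h5 := mul_le_mul_of_nonneg_left h4 (show 0 ≤ 4 * (lam k)⁻¹ by positivity)
    have h6 : 4 * (lam k)⁻¹ * (lam k / 4 * S) = S := by field_simp
    rw [h6] at h5
    refine h5.trans (le_of_eq ?_)
    ring
  have h7 := mul_le_mul_of_nonneg_left hS hδ0
  refine max_le ?_ (by positivity)
  linarith

theorem IsRun.x_succ_sub (hr : IsRun f (ind C) g α lam σ x z v) (k : ℕ) :
    x (k + 1) - x k = α k • (v k - x k) := by
  rw [hr.x_step]; abel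

/-- One step of the conditional gradient method. -/
theorem IsRun.exists_descent (hr : IsRun f (ind C) g α lam σ x z v)
    (hs : StandingAssumption f (ind C) g) (hC : Convex ℝ C) {Z : ℝ} (hZ0 : 0 ≤ Z)
    (hZ : ∀ k i, z k i ≤ Z) :
    ∃ c : ℝ, 0 < c ∧ ∀ k, smoothPart f g (lam k) (x (k + 1)) (z k) ≤
      smoothPart f g (lam k) (x k) (z k) -
        α k * inner ℝ (gradient (fun y => smoothPart f g (lam k) y (z k)) (x k)) (x k - v k) +
        α k * (c * (lam k * α k)) * ‖v k - x k‖ ^ 2 := by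
  obtain ⟨M, hM, hfM, hgM⟩ := hs.exists_bounds
  obtain ⟨c, hc, h⟩ := exists_smoothPart_descent hs.f_differentiable hs.g_differentiable hM hfM
    hgM (hr.lam_pos 0) hZ0
  refine ⟨c, hc, fun k => ?_⟩
  have h1 := h (lam k) (hr.lam_strictMono.monotone (Nat.zero_le k)) (z k) (hZ k) (x k)
    (hr.x_mem hC k) (x (k + 1)) (hr.x_mem hC (k + 1))
  rw [hr.x_succ_sub, norm_smul, real_inner_smul_right, mul_pow, Real.norm_eq_abs, sq_abs] at h1
  have h2 : ∀ u : EuclideanSpace ℝ (Fin n), inner ℝ u (v k - x k) = - inner ℝ u (x k - v k) :=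
    fun u => by rw [← inner_neg_right, neg_sub]
  rw [h2] at h1
  linarith

/-- A form of Young's inequality, split at `d ^ (q - 2) = 2 * a / κ`: above it the power `q`
dominates, below it `d` is small. The factor `1 / 2` lets half of the Frank-Wolfe gap pay for the
curvature term. -/
theorem sq_le_half_rpow_add {q κ a d : ℝ} (hq : 2 < q) (hκ : 0 < κ) (ha : 0 ≤ a) (hd : 0 ≤ d) :
    a * d ^ 2 ≤ κ * d ^ q / 2 + a * (2 * a / κ) ^ (2 / (q - 2)) := by
  have hq2 : 0 < q - 2 := by linarith
  rcases le_or_gt (2 * a / κ) (d ^ (q - 2)) with h | h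
  · rw [div_le_iff₀ hκ] at h
    have h1 : d ^ q = d ^ (q - 2) * d ^ 2 := by
      rw [← Real.rpow_natCast d 2, ← Real.rpow_add' hd (by push_cast; linarith)]
      push_cast; ring_nf
    have h2 := mul_le_mul_of_nonneg_right h (sq_nonneg d)
    have h3 : 0 ≤ a * (2 * a / κ) ^ (2 / (q - 2)) := by positivity
    rw [h1]; linarith
  · have h1 : d ^ 2 = (d ^ (q - 2)) ^ (2 / (q - 2)) := by
      rw [← Real.rpow_mul hd, mul_div_cancel₀ _ hq2.ne', ← Real.rpow_natCast d 2]; norm_num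
    have h2 : d ^ 2 ≤ (2 * a / κ) ^ (2 / (q - 2)) := by
      rw [h1]; gcongr
    have h3 := mul_le_mul_of_nonneg_left h2 ha
    have h4 : 0 ≤ κ * d ^ q / 2 := by positivity
    linarith

/-- Eventually the multiplier estimates and the iterates lie in `𝓐_ε`, when the optimality gap is
bounded. -/
theorem IsRun.eventually_mem_setA (hr : IsRun f (ind C) g α lam σ x z v) {ε K fs Z A : ℝ}
    (hε : 0 < ε) (hA : ∀ᶠ k in atTop, smoothPart f g (lam k) (x k) (z k) - fs ≤ A)
    (hK : ∀ k, lam k / 4 * ∑ i, (max (g i (x k)) (-z k i / lam k)) ^ 2 ≤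
      smoothPart f g (lam k) (x k) (z k) - fs + K / lam k) (hK0 : 0 ≤ K)
    (hZ : ∀ k i, z k i ≤ Z) :
    ∀ᶠ k in atTop, (x k, multiplier g (lam k) (x k) (z k)) ∈ setA g ε := by
  -- Once `lam k ≥ 4 (A + K) / ε²`, a violation above `ε` would contradict `hK`; once `lam k ≥ Z /
  -- ε`, a constraint below `-ε` has `lam k * g i + z i ≤ 0`.
  filter_upwards [hA, hr.lam_tendsto.eventually_ge_atTop 1,
    hr.lam_tendsto.eventually_ge_atTop (4 * (A + K) / ε ^ 2),
    hr.lam_tendsto.eventually_ge_atTop (Z / ε)] with k hA h1 h2 h3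
  have hl := hr.lam_pos k
  rw [div_le_iff₀ (by positivity)] at h2 h3
  refine ⟨fun i => ?_, fun i => le_max_right _ _, fun i hi => ?_⟩
  · by_contra! hgi
    have h4 : ε ^ 2 < (max (g i (x k)) (-z k i / lam k)) ^ 2 :=
      pow_lt_pow_left₀ (hgi.trans_le (le_max_left _ _)) hε.le two_ne_zero
    have h5 := Finset.single_le_sum (f := fun i => (max (g i (x k)) (-z k i / lam k)) ^ 2)
      (fun i _ => sq_nonneg _) (Finset.mem_univ i)
    have h6 := mul_lt_mul_of_pos_left (h4.trans_le h5) (show 0 < lam k / 4 by positivity)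
    have h7 : K / lam k ≤ K := div_le_self hK0 h1
    linarith [hK k]
  · rw [multiplier_apply]
    refine max_eq_right ?_
    have := mul_lt_mul_of_pos_left hi hl
    simp only at this
    linarith [hZ k i]

end CGAL

namespace CGAL

open Filter Asymptotics

variable {n m : ℕ} {f : EuclideanSpace ℝ (Fin n) → ℝ}
  {g : Fin m → EuclideanSpace ℝ (Fin n) → ℝ}
  {C : Set (EuclideanSpace ℝ (Fin n))} {α lam σ : ℕ → ℝ} {x v : ℕ → EuclideanSpace ℝ (Fin n)}
  {z : ℕ → EuclideanSpace ℝ (Fin m)}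

/-! ### Rates of convergence -/

theorem IsRun.exists_multiplier_bound (hr : IsRun f (ind C) g α lam σ x z v)
    (hs : StandingAssumption f (ind C) g) (hC : Convex ℝ C) :
    ∃ Z, 0 ≤ Z ∧ ∀ k i, z k i ≤ Z := by
  obtain ⟨M, hM, -, hgM⟩ := hs.exists_bounds
  exact hr.exists_z_le hC hM fun i y hy => (le_abs_self _).trans (hgM i y hy y hy).1

theorem OpenLoop.isBigO_lam_mul {τ p γ : ℝ} (hl : OpenLoop τ p γ α lam σ) (c : ℝ) :
    (fun k => c * (lam k * α k)) =O[atTop] fun k : ℕ => (k : ℝ) ^ (-(p - τ)) :=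
  (isBigO_mul_rpow hl.lam_theta.isBigO hl.α_theta.isBigO (by ring)).const_mul_left c

/-- The rate obtained from a primal decrease estimate with remainder `R`. -/
theorem IsRun.isBigO_gap_of_remainder {τ p γ : ℝ} {xs : EuclideanSpace ℝ (Fin n)}
    {zs : EuclideanSpace ℝ (Fin m)} (hr : IsRun f (ind C) g α lam σ x z v)
    (hs : StandingAssumption f (ind C) g) (hC : Convex ℝ C) (hl : OpenLoop τ p γ α lam σ)
    (hk : IsKKT f (ind C) g xs zs) {R : ℕ → ℝ} {r : ℝ} (hR0 : ∀ k, 0 ≤ R k)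
    (hB : ∀ᶠ k in atTop, smoothPart f g (lam k) (x (k + 1)) (z k) - f xs ≤
      (1 - α k / 2) * max (smoothPart f g (lam k) (x k) (z k) - f xs) 0 + R k)
    (hR : R =O[atTop] fun k : ℕ => (k : ℝ) ^ (-(p + r))) (hr0 : 0 < r) (hr1 : r ≤ 1 - p + τ) :
    (fun k => max (smoothPart f g (lam k) (x k) (z k) - f xs) 0) =O[atTop]
      fun k : ℕ => (k : ℝ) ^ (-r) := by
  obtain ⟨Z, -, hZ⟩ := hr.exists_multiplier_bound hs hC
  refine hl.isBigO_of_step (fun k => le_max_right _ _)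
    (fun k => hr.gap_succ_le k (sum_sq_le_smoothPart hk.dual_nonneg
      (hk.saddle hs (hr.x_mem hC (k + 1))) (hr.lam_pos k) (hr.z_nonneg k) (hZ k))
      (Finset.sum_nonneg fun i _ => sq_nonneg _)) ?_ hR hr0 hr1
  filter_upwards [hB] with k hB
  refine max_le hB (add_nonneg (mul_nonneg ?_ (le_max_right _ _)) (hR0 k))
  linarith [(hl.α_mem k).2]

/-- The rate valid on every bounded convex set. -/
theorem IsRun.isBigO_gap_of_bounded {τ p γ : ℝ} {xs : EuclideanSpace ℝ (Fin n)}
    {zs : EuclideanSpace ℝ (Fin m)} (hr : IsRun f (ind C) g α lam σ x z v)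
    (hs : StandingAssumption f (ind C) g) (hC : Convex ℝ C) (hl : OpenLoop τ p γ α lam σ)
    (hk : IsKKT f (ind C) g xs zs) :
    (fun k => max (smoothPart f g (lam k) (x k) (z k) - f xs) 0) =O[atTop]
      fun k : ℕ => (k : ℝ) ^ (-min (p - τ) (1 - p + τ)) := by
  obtain ⟨Z, hZ0, hZ⟩ := hr.exists_multiplier_bound hs hC
  obtain ⟨c, hc, hdes⟩ := hr.exists_descent hs hC hZ0 hZ
  obtain ⟨D, hD0, hD⟩ := hs.h_bounded
  rw [dom_ind] at hD
  have hα0 := fun k => (hl.α_mem k).1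
  have hlam0 := hl.lam_pos
  refine hr.isBigO_gap_of_remainder hs hC hl hk (R := fun k => α k * (c * (lam k * α k)) * D ^ 2)
    (fun k => ?_) (Eventually.of_forall fun k => ?_) ?_
    (lt_min (by linarith [hl.p_mem.1]) (by linarith [hl.p_mem.2, hl.τ_mem.1])) (min_le_right _ _)
  · have := hα0 k
    have := hlam0 k
    positivity
  · have h1 := hdes k
    have h2 := hr.gap_le hs (hk.mem hr.nonempty) hk.feasible k
    have h3 : 0 ≤ inner ℝ (gradient (fun y => smoothPart f g (lam k) y (z k)) (x k))
        (x k - v k) := by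
      rw [inner_sub_right, sub_nonneg]
      exact (hr.v_step k).inner_le (hr.x_mem hC k)
    -- The full gap gives the contraction `1 - α k`; only `1 - α k / 2` is required, and `h8`
    -- discards the excess.
    have h4 := mul_le_mul_of_nonneg_left (max_le h2 h3) (hα0 k).le
    have h5 : ‖v k - x k‖ ^ 2 ≤ D ^ 2 := by
      gcongr; exact hD _ (hr.v_mem k) _ (hr.x_mem hC k)
    have h6 := mul_le_mul_of_nonneg_left h5 (show 0 ≤ α k * (c * (lam k * α k)) from by
      have := hα0 k; have := hlam0 k; positivity)
    have h7 := le_max_left (smoothPart f g (lam k) (x k) (z k) - f xs) 0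
    have h8 := mul_nonneg (hα0 k).le
      (le_max_right (smoothPart f g (lam k) (x k) (z k) - f xs) 0)
    linarith
  · have h1 := isBigO_mul_rpow hl.α_theta.isBigO (hl.isBigO_lam_mul c) (c := -(p + (p - τ)))
      (by ring)
    have h2 := (h1.const_mul_left (D ^ 2)).trans
      (isBigO_natCast_rpow (b := -(p + min (p - τ) (1 - p + τ)))
        (by linarith [min_le_left (p - τ) (1 - p + τ)]))
    simpa only [mul_comm (D ^ 2)] using h2

/-- Eventually the Frank-Wolfe gap controls a power of the distance to the oracle point. -/
theorem IsRun.exists_eventually_rpow_le {τ p γ ν q : ℝ} {xs : EuclideanSpace ℝ (Fin n)}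
    {zs : EuclideanSpace ℝ (Fin m)} (hr : IsRun f (ind C) g α lam σ x z v)
    (hs : StandingAssumption f (ind C) g) (hu : UCAssumption f (ind C) g C ν q)
    (hl : OpenLoop τ p γ α lam σ) (hk : IsKKT f (ind C) g xs zs) :
    ∃ κ, 0 < κ ∧ ∀ᶠ k in atTop, κ * ‖v k - x k‖ ^ q ≤
      inner ℝ (gradient (fun y => smoothPart f g (lam k) y (z k)) (x k)) (x k - v k) := by
  have hC := hu.uniformlyConvex.convex
  have hν := hu.uniformlyConvex.ν_pos
  obtain ⟨Z, -, hZ⟩ := hr.exists_multiplier_bound hs hC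
  obtain ⟨ε, hε, ζ, hζ, hgrad⟩ := hu.grad_bound
  -- Bootstrap: the rate without uniform convexity already bounds the gap, which is what membership
  -- in `setA` requires.
  have hT := (hr.isBigO_gap_of_bounded hs hC hl hk).trans_tendsto
    (tendsto_natCast_rpow_neg (neg_neg_of_pos
      (lt_min (by linarith [hl.p_mem.1]) (by linarith [hl.p_mem.2, hl.τ_mem.1]))))
  have hA : ∀ᶠ k in atTop, smoothPart f g (lam k) (x k) (z k) - f xs ≤ 1 := by
    filter_upwards [hT.eventually_lt_const one_pos] with k hk1
    exact (le_max_left _ _).trans hk1.le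
  refine ⟨ν / 2 * ζ, by positivity, ?_⟩
  filter_upwards [hr.eventually_mem_setA hε hA (fun k => sum_sq_le_smoothPart hk.dual_nonneg
      (hk.saddle hs (hr.x_mem hC k)) (hr.lam_pos k) (hr.z_nonneg k) (hZ k))
      (Finset.sum_nonneg fun i _ => sq_nonneg _) hZ] with k hmem
  have h1 := hgrad _ _ hmem (hr.x_mem hC k)
  rw [← gradient_smoothPart hs.f_differentiable hs.g_differentiable (hr.lam_pos k)] at h1
  refine le_trans ?_ (hu.uniformlyConvex.le_inner (hr.v_step k) (hr.x_mem hC k))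
  gcongr

/-- Since `τ < p`, `c λ α` eventually falls below `κ / 2`, and half of the Frank-Wolfe gap covers
the whole curvature term. With no remainder, only the cap from the penalty update is left. -/
theorem IsRun.isBigO_gap_of_strongly_convex {τ p γ ν : ℝ} {xs : EuclideanSpace ℝ (Fin n)}
    {zs : EuclideanSpace ℝ (Fin m)} (hr : IsRun f (ind C) g α lam σ x z v)
    (hs : StandingAssumption f (ind C) g) (hu : UCAssumption f (ind C) g C ν 2)
    (hl : OpenLoop τ p γ α lam σ) (hk : IsKKT f (ind C) g xs zs) :
    (fun k => max (smoothPart f g (lam k) (x k) (z k) - f xs) 0) =O[atTop]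
      fun k : ℕ => (k : ℝ) ^ (-(1 - p + τ)) := by
  have hC := hu.uniformlyConvex.convex
  obtain ⟨Z, hZ0, hZ⟩ := hr.exists_multiplier_bound hs hC
  obtain ⟨c, hc, hdes⟩ := hr.exists_descent hs hC hZ0 hZ
  obtain ⟨κ, hκ, hgap⟩ := hr.exists_eventually_rpow_le hs hu hl hk
  have hsmall : ∀ᶠ k in atTop, c * (lam k * α k) < κ / 2 :=
    ((hl.isBigO_lam_mul c).trans_tendsto (tendsto_natCast_rpow_neg
      (by linarith [hl.p_mem.1]))).eventually_lt_const (by positivity)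
  refine hr.isBigO_gap_of_remainder hs hC hl hk (R := fun _ => 0) (fun k => le_rfl) ?_
    (isBigO_zero _ _) (by linarith [hl.p_mem.2, hl.τ_mem.1]) le_rfl
  filter_upwards [hgap, hsmall] with k h1 h2
  rw [Real.rpow_two] at h1
  have hα0 := (hl.α_mem k).1
  have h3 := hdes k
  have h4 := hr.gap_le hs (hk.mem hr.nonempty) hk.feasible k
  set G := inner ℝ (gradient (fun y => smoothPart f g (lam k) y (z k)) (x k)) (x k - v k)
  have h5 : 0 ≤ G := le_trans (by positivity) h1
  have h6 := mul_le_mul_of_nonneg_left (max_le h4 h5) hα0.le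
  have h7 : c * (lam k * α k) * ‖v k - x k‖ ^ 2 ≤ G / 2 := by
    have := mul_le_mul_of_nonneg_right h2.le (sq_nonneg ‖v k - x k‖)
    linarith
  have h8 := mul_le_mul_of_nonneg_left h7 hα0.le
  have h9 := le_max_left (smoothPart f g (lam k) (x k) (z k) - f xs) 0
  linarith

/-- With `a = c λ α = O(k^(-(p - τ)))`, the curvature not paid by half of the gap is of order `α
a^(1 + 2 / (q - 2))`; this is the source of `hr2`. -/
theorem IsRun.isBigO_gap_of_uniformly_convex {τ p γ ν q r : ℝ} {xs : EuclideanSpace ℝ (Fin n)}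
    {zs : EuclideanSpace ℝ (Fin m)} (hr : IsRun f (ind C) g α lam σ x z v)
    (hs : StandingAssumption f (ind C) g) (hu : UCAssumption f (ind C) g C ν q) (hq : 2 < q)
    (hl : OpenLoop τ p γ α lam σ) (hk : IsKKT f (ind C) g xs zs) (hr0 : 0 < r)
    (hr1 : r ≤ 1 - p + τ) (hr2 : r ≤ (p - τ) * (1 + 2 / (q - 2))) :
    (fun k => max (smoothPart f g (lam k) (x k) (z k) - f xs) 0) =O[atTop]
      fun k : ℕ => (k : ℝ) ^ (-r) := by
  have hC := hu.uniformlyConvex.convex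
  have hq2 : 0 < q - 2 := by linarith
  obtain ⟨Z, hZ0, hZ⟩ := hr.exists_multiplier_bound hs hC
  obtain ⟨c, hc, hdes⟩ := hr.exists_descent hs hC hZ0 hZ
  obtain ⟨κ, hκ, hgap⟩ := hr.exists_eventually_rpow_le hs hu hl hk
  have hα0 := fun k => (hl.α_mem k).1
  have ha0 : ∀ k, 0 ≤ c * (lam k * α k) := fun k => by
    have := hα0 k; have := hl.lam_pos k; positivity
  refine hr.isBigO_gap_of_remainder hs hC hl hk (R := fun k => α k * (c * (lam k * α k) *
    (2 * (c * (lam k * α k)) / κ) ^ (2 / (q - 2)))) (fun k => ?_) ?_ ?_ hr0 hr1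
  · have := hα0 k; have := ha0 k; positivity
  · filter_upwards [hgap] with k h1
    have h3 := hdes k
    have h4 := hr.gap_le hs (hk.mem hr.nonempty) hk.feasible k
    have h2 := sq_le_half_rpow_add hq hκ (ha0 k) (norm_nonneg (v k - x k))
    set G := inner ℝ (gradient (fun y => smoothPart f g (lam k) y (z k)) (x k)) (x k - v k)
    set a := c * (lam k * α k)
    have h5 : 0 ≤ G := le_trans (by positivity) h1
    have h6 := mul_le_mul_of_nonneg_left (max_le h4 h5) (hα0 k).le
    have h7 : a * ‖v k - x k‖ ^ 2 ≤ G / 2 + a * (2 * a / κ) ^ (2 / (q - 2)) := by linarith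
    have h8 := mul_le_mul_of_nonneg_left h7 (hα0 k).le
    have h9 := le_max_left (smoothPart f g (lam k) (x k) (z k) - f xs) 0
    linarith
  · have h1 := hl.isBigO_lam_mul c
    have h2 : (fun k => 2 * (c * (lam k * α k)) / κ) =O[atTop]
        fun k : ℕ => (k : ℝ) ^ (-(p - τ)) := by
      simpa only [div_eq_inv_mul, mul_assoc] using
        (h1.const_mul_left 2).const_mul_left κ⁻¹
    have h3 := isBigO_rpow_rpow (b := 2 / (q - 2)) (by positivity) h2 rfl
    have h4 := isBigO_mul_rpow hl.α_theta.isBigO (isBigO_mul_rpow h1 h3 rfl) rfl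
    exact h4.trans (isBigO_natCast_rpow (by linarith))

/-- If the optimality gap is at most of the order of the inverse penalty, then so is the constraint
violation. -/
theorem IsRun.isBigO_infeasibility {τ p γ : ℝ} {xs : EuclideanSpace ℝ (Fin n)}
    {zs : EuclideanSpace ℝ (Fin m)} (hr : IsRun f (ind C) g α lam σ x z v)
    (hs : StandingAssumption f (ind C) g) (hC : Convex ℝ C)
    (hl : OpenLoop τ p γ α lam σ) (hk : IsKKT f (ind C) g xs zs)
    (hT : (fun k => max (smoothPart f g (lam k) (x k) (z k) - f xs) 0) =O[atTop]
      fun k : ℕ => (k : ℝ) ^ (-τ)) :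
    (fun k => ‖(WithLp.toLp 2 fun i => max (g i (x k)) 0 : EuclideanSpace ℝ (Fin m))‖)
      =O[atTop] fun k : ℕ => (k : ℝ) ^ (-τ) := by
  obtain ⟨Z, -, hZ⟩ := hr.exists_multiplier_bound hs hC
  have hinv : (fun k => (lam k)⁻¹) =O[atTop] fun k : ℕ => (k : ℝ) ^ (-τ) :=
    isBigO_inv_rpow hl.lam_theta.isBigO_symm
  -- The squared violation is at most `4 / λ * (T + K / λ)`, in which both factors are `O(k^(-τ))`.
  refine IsBigO.of_pow (n := 2) two_ne_zero ?_
  have h1 := (hinv.mul (hT.add (hinv.const_mul_left (∑ i, (Z + zs i) ^ 2)))).const_mul_left 4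
  refine (IsBigO.of_bound 1 (Eventually.of_forall fun k => ?_)).trans
    (h1.congr_right fun k => (sq _).symm)
  have hlam := hl.lam_pos k
  have h2 := sum_sq_le_smoothPart (Z := Z) hk.dual_nonneg (hk.saddle hs (hr.x_mem hC k))
    hlam (hr.z_nonneg k) (hZ k)
  have h3 : ∑ i, (max (g i (x k)) 0) ^ 2 ≤ ∑ i, (max (g i (x k)) (-z k i / lam k)) ^ 2 := by
    refine Finset.sum_le_sum fun i _ => ?_
    rcases le_total (g i (x k)) 0 with h | h
    · rw [max_eq_right h, zero_pow two_ne_zero]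
      exact sq_nonneg _
    · rw [max_eq_left h]
      exact pow_le_pow_left₀ h (le_max_left _ _) 2
  have h4 := le_max_left (smoothPart f g (lam k) (x k) (z k) - f xs) 0
  have h5 : ∑ i, (max (g i (x k)) 0) ^ 2 ≤ 4 * ((lam k)⁻¹ *
      (max (smoothPart f g (lam k) (x k) (z k) - f xs) 0 +
        (∑ i, (Z + zs i) ^ 2) * (lam k)⁻¹)) := by
    rw [div_eq_mul_inv (∑ i, (Z + zs i) ^ 2)] at h2
    have h6 := mul_le_mul_of_nonneg_left (h2.trans (add_le_add_left h4 _))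
      (show 0 ≤ 4 * (lam k)⁻¹ by positivity)
    have h7 : ∀ S, 4 * (lam k)⁻¹ * (lam k / 4 * S) = S := fun S => by field_simp
    rw [h7] at h6
    linarith
  simp only [Pi.pow_apply]
  rw [one_mul, Real.norm_of_nonneg (sq_nonneg _), EuclideanSpace.norm_sq_eq]
  refine le_trans ?_ (le_abs_self _)
  simpa only [Real.norm_eq_abs, sq_abs] using h5

/-- If the optimality gap is at most of the order of the inverse penalty, then so is the objective
gap. -/
theorem IsRun.isBigO_objective {τ p γ : ℝ} {xs : EuclideanSpace ℝ (Fin n)}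
    {zs : EuclideanSpace ℝ (Fin m)} (hr : IsRun f (ind C) g α lam σ x z v)
    (hs : StandingAssumption f (ind C) g) (hC : Convex ℝ C)
    (hl : OpenLoop τ p γ α lam σ) (hk : IsKKT f (ind C) g xs zs)
    (hT : (fun k => max (smoothPart f g (lam k) (x k) (z k) - f xs) 0) =O[atTop]
      fun k : ℕ => (k : ℝ) ^ (-τ)) :
    (fun k => f (x k) - f xs) =O[atTop] fun k : ℕ => (k : ℝ) ^ (-τ) := by
  obtain ⟨Z, hZ0, hZ⟩ := hr.exists_multiplier_bound hs hC
  have hinv : (fun k => (lam k)⁻¹) =O[atTop] fun k : ℕ => (k : ℝ) ^ (-τ) :=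
    isBigO_inv_rpow hl.lam_theta.isBigO_symm
  have hinf := hr.isBigO_infeasibility hs hC hl hk hT
  have h1 := (hT.add (hinv.const_mul_left (m * (Z ^ 2 / 2)))).add
    (hinf.const_mul_left (∑ i, zs i))
  refine (IsBigO.of_bound 1 (Eventually.of_forall fun k => ?_)).trans h1
  have hlam := hl.lam_pos k
  rw [one_mul]
  refine le_trans ?_ (le_abs_self _)
  have h2 := hk.saddle hs (hr.x_mem hC k)
  set N := ‖(WithLp.toLp 2 fun i => max (g i (x k)) 0 : EuclideanSpace ℝ (Fin m))‖ with hN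
  have h3 : ∑ i, zs i * g i (x k) ≤ (∑ i, zs i) * N := by
    rw [Finset.sum_mul]
    refine Finset.sum_le_sum fun i _ => mul_le_mul_of_nonneg_left ?_ (hk.dual_nonneg i)
    have h4 := PiLp.norm_apply_le
      (WithLp.toLp 2 fun i => max (g i (x k)) 0 : EuclideanSpace ℝ (Fin m)) i
    exact (le_max_left _ _).trans ((le_abs_self _).trans h4)
  have h5 : -(m * (Z ^ 2 / 2) * (lam k)⁻¹) ≤ ∑ i, psi (lam k) (g i (x k)) (z k i) := by
    have h6 : ∑ _i : Fin m, -(Z ^ 2 / 2 * (lam k)⁻¹) ≤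
        ∑ i, psi (lam k) (g i (x k)) (z k i) := by
      refine Finset.sum_le_sum fun i _ => le_trans ?_ (neg_sq_le_psi hlam _ _)
      rw [neg_le_neg_iff]
      have h7 : (z k i) ^ 2 ≤ Z ^ 2 := pow_le_pow_left₀ (hr.z_nonneg k i) (hZ k i) 2
      have h8 : Z ^ 2 / 2 * (lam k)⁻¹ = Z ^ 2 / (2 * lam k) := by field_simp
      rw [h8]; gcongr
    rw [Finset.sum_const, Finset.card_univ, Fintype.card_fin, nsmul_eq_mul] at h6
    linarith
  have h9 := le_max_left (smoothPart f g (lam k) (x k) (z k) - f xs) 0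
  have h10 := le_max_right (smoothPart f g (lam k) (x k) (z k) - f xs) 0
  have h11 : 0 ≤ m * (Z ^ 2 / 2) * (lam k)⁻¹ := by positivity
  have h12 : 0 ≤ (∑ i, zs i) * N :=
    mul_nonneg (Finset.sum_nonneg fun i _ => hk.dual_nonneg i) (norm_nonneg _)
  have h13 : smoothPart f g (lam k) (x k) (z k) =
    f (x k) + ∑ i, psi (lam k) (g i (x k)) (z k i) := rfl
  -- The lower bound is the saddle inequality `h2` with `h3`; the upper bound subtracts the `psi`
  -- terms, bounded below in `h5`, from the gap.
  rw [Real.norm_eq_abs, abs_le]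
  constructor <;> linarith

/-! ### Extended-real reformulation -/

theorem hasRate_coe {a : ℕ → EReal} {b r : ℕ → ℝ} (hab : ∀ k, a k = (b k : EReal))
    (hb : b =O[atTop] r) : HasRate a r := by
  refine ⟨fun k => ?_, ?_⟩
  · rw [hab]; exact ⟨EReal.coe_ne_bot _, EReal.coe_ne_top _⟩
  · simpa only [hab, EReal.toReal_coe] using hb

theorem IsKKT.gapT_eq {xs : EuclideanSpace ℝ (Fin n)} {zs : EuclideanSpace ℝ (Fin m)}
    (hk : IsKKT f (ind C) g xs zs) (hs : StandingAssumption f (ind C) g) {l : ℝ}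
    {y : EuclideanSpace ℝ (Fin n)} (hy : y ∈ C) (w : EuclideanSpace ℝ (Fin m)) :
    gapT f (ind C) g l y w = ((max (smoothPart f g l y w - f xs) 0 : ℝ) : EReal) := by
  rw [gapT, augLagrangian, hk.optValue_eq hs ⟨y, hy⟩, ind_of_mem hy, add_zero,
    EReal.coe_strictMono.monotone.map_max, EReal.coe_sub, EReal.coe_zero]

end CGAL

theorem proposition5p4 {n m : ℕ} (f : EuclideanSpace ℝ (Fin n) → ℝ)
    (h : EuclideanSpace ℝ (Fin n) → EReal) (g : Fin m → EuclideanSpace ℝ (Fin n) → ℝ)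
    (C : Set (EuclideanSpace ℝ (Fin n))) (ν q μ : ℝ)
    (hstd : CGAL.StandingAssumption f h g) (huc : CGAL.UCAssumption f h g C ν q)
    (hμ : μ = 1 - 2 / q) :
    (∀ (τ p γ ω : ℝ) (α lam σ : ℕ → ℝ) (x : ℕ → EuclideanSpace ℝ (Fin n))
        (z : ℕ → EuclideanSpace ℝ (Fin m)) (v : ℕ → EuclideanSpace ℝ (Fin n)),
      CGAL.OpenLoop τ p γ α lam σ → CGAL.IsRun f h g α lam σ x z v →
      ω = min (p - τ) (1 - p + τ) →
      (μ = 0 →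
        CGAL.HasRate (fun k => CGAL.gapT f h g (lam k) (x k) (z k))
          (fun k => (k : ℝ) ^ (-(1 - p + τ)))) ∧
      (μ ∈ Set.Ioo (0 : ℝ) 1 →
        CGAL.HasRate (fun k => CGAL.gapT f h g (lam k) (x k) (z k))
          (fun k => max ((k : ℝ) ^ (-((1 - μ) * ω + p - τ))) ((k : ℝ) ^ (-(1 - p + τ)))))) ∧
    (μ = 0 → ∀ ρ : ℝ, ρ < 1 → ∃ τ₀ : ℝ, τ₀ < 1 ∧
      ∀ (τ p γ : ℝ) (α lam σ : ℕ → ℝ) (x : ℕ → EuclideanSpace ℝ (Fin n))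
        (z : ℕ → EuclideanSpace ℝ (Fin m)) (v : ℕ → EuclideanSpace ℝ (Fin n)),
      τ₀ < τ → CGAL.OpenLoop τ p γ α lam σ → CGAL.IsRun f h g α lam σ x z v →
      CGAL.HasRate (fun k => CGAL.gapT f h g (lam k) (x k) (z k)) (fun k => (k : ℝ) ^ (-ρ)) ∧
      CGAL.HasRate (fun k => (f (x k) : EReal) + h (x k) - CGAL.optValue f h g)
        (fun k => (k : ℝ) ^ (-ρ)) ∧
      Asymptotics.IsBigO Filter.atTop
        (fun k => ‖(WithLp.toLp 2 fun i => max (g i (x k)) 0 : EuclideanSpace ℝ (Fin m))‖)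
        (fun k : ℕ => (k : ℝ) ^ (-ρ))) := by
  obtain rfl := huc.h_eq
  have hC := huc.uniformlyConvex.convex
  have hq := huc.uniformlyConvex.two_le_q
  have hq0 : 0 < q := by linarith
  obtain ⟨xs, zs, hk⟩ := hstd.exists_kkt
  have hq2 : μ = 0 → q = 2 := fun h0 => by
    rw [hμ, sub_eq_zero, eq_div_iff hq0.ne'] at h0; linarith
  refine ⟨fun τ p γ ω α lam σ x z v hl hr hω => ⟨fun h0 => ?_, fun hμ01 => ?_⟩,
    -- The choice `τ₀ = ρ` works because `p < 1` gives `1 - p + τ > τ > ρ`.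
    fun h0 ρ hρ => ⟨ρ, hρ, fun τ p γ α lam σ x z v hτ hl hr => ?_⟩⟩
  · obtain rfl := hq2 h0
    exact CGAL.hasRate_coe (fun k => hk.gapT_eq hstd (hr.x_mem hC k) _)
      (hr.isBigO_gap_of_strongly_convex hstd huc hl hk)
  · obtain ⟨hμ0, hμ1⟩ := hμ01
    have hq2 : 2 < q := by
      rw [hμ, sub_pos, div_lt_one hq0] at hμ0; exact hμ0
    have hpτ : 0 < p - τ := by linarith [hl.p_mem.1]
    have hω0 : 0 < ω := by
      rw [hω]; exact lt_min hpτ (by linarith [hl.p_mem.2, hl.τ_mem.1])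
    have hω1 : ω ≤ p - τ := hω ▸ min_le_left _ _
    have hexp : (1 : ℝ) + 2 / (q - 2) = 1 / μ := by
      have : q - 2 ≠ 0 := by linarith
      have h3 : μ = (q - 2) / q := by rw [hμ]; field_simp
      rw [h3]; field_simp; ring
    -- The method yields the exponent `(p - τ) / μ`, capped at `1 - p + τ`. It is at least the
    -- claimed one, since `ω ≤ p - τ` and `2 - μ ≤ 1 / μ`, the latter being `(1 - μ)² ≥ 0`.
    have hle : (1 - μ) * ω + p - τ ≤ (p - τ) * (1 + 2 / (q - 2)) := by
      have h1 : (1 - μ) * ω ≤ (1 - μ) * (p - τ) :=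
        mul_le_mul_of_nonneg_left hω1 (by linarith)
      have h2 : 2 - μ ≤ 1 / μ := by
        rw [le_div_iff₀ hμ0]; nlinarith [sq_nonneg (1 - μ)]
      have h3 := mul_le_mul_of_nonneg_left h2 hpτ.le
      rw [hexp]; linarith
    have hpos : 0 < (1 - μ) * ω + p - τ := by
      have := mul_pos (sub_pos.2 hμ1) hω0
      linarith
    have hrate := hr.isBigO_gap_of_uniformly_convex hstd huc hq2 hl hk
      (lt_min hpos (show 0 < 1 - p + τ by linarith [hl.p_mem.2, hl.τ_mem.1]))
      (min_le_right _ _) ((min_le_left _ _).trans hle)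
    refine CGAL.hasRate_coe (fun k => hk.gapT_eq hstd (hr.x_mem hC k) _) (hrate.trans ?_)
    refine Asymptotics.IsBigO.of_bound 1 (Filter.Eventually.of_forall fun k => ?_)
    rw [one_mul, Real.norm_of_nonneg (by positivity), Real.norm_of_nonneg (by positivity)]
    rcases min_choice ((1 - μ) * ω + p - τ) (1 - p + τ) with h | h <;> rw [h]
    · exact le_max_left _ _
    · exact le_max_right _ _
  · obtain rfl := hq2 h0
    have hT := (hr.isBigO_gap_of_strongly_convex hstd huc hl hk).trans
      (CGAL.isBigO_natCast_rpow (b := -τ) (by linarith [hl.p_mem.2]))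
    have hρτ := CGAL.isBigO_natCast_rpow (neg_le_neg hτ.le)
    refine ⟨CGAL.hasRate_coe (fun k => hk.gapT_eq hstd (hr.x_mem hC k) _) (hT.trans hρτ),
      CGAL.hasRate_coe (fun k => ?_) ((hr.isBigO_objective hstd hC hl hk hT).trans hρτ),
      (hr.isBigO_infeasibility hstd hC hl hk hT).trans hρτ⟩
    rw [CGAL.ind_of_mem (hr.x_mem hC k), add_zero, hk.optValue_eq hstd hr.nonempty,
      EReal.coe_sub]
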